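/- A Lie algebroid over an $m$-dimensional smooth (Hausdorff) manifold $M$ is a smooth real vector bundle $A\to M$ of finite rank $r$, together with a real Lie algebra structure $[\,,]$ on the space $\Gamma(A)$ of smooth sections and a smooth bundle map $\#:A\to TM$ covering the identity (the anchor), such that $\#:\Gamma(A)\to\mathfrak X(M)$ is a Lie algebra homomorphism and $[\alpha,f\beta]=f[\alpha,\beta]+\#\alpha(f)\,\beta$ for all $\alpha,\beta\in\Gamma(A)$ and $f\in C^\infty(M)$. **Theorem (Local Splitting).** Let $A\to M$ be a Lie algebroid and let $x_0\in M$ be a point where $\#_{x_0}$ has rank $q$. Then $q\le m$, $q\le r$, and there exist smooth coordinates $(x^1,\dots,x^q,y^{q+1},\dots,y^m)$ defined on an open neighborhood $U$ of $x_0$ and vanishing at $x_0$, and smooth sections $\alpha^1,\dots,\alpha^r$ of $A$ whose restrictions to $U$ form a basis of sections of $A$ over $U$, such that on $U$ $$\#\alpha^i=\frac{\partial}{\partial x^i}\quad(i=1,\dots,q),\qquad \#\alpha^s=\sum_{j=q+1}^m b^{sj}\frac{\partial}{\partial y^j}\quad(s=q+1,\dots,r),$$ where the $b^{sj}\in C^\infty(U)$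 ($s,j>q$) depend only on the $y$'s (i.e. $b^{sj}(p)=b^{sj}(p')$ whenever $p,p'\in U$ have the same $y$-coordinates) and $b^{sj}(x_0)=0$. Moreover, there are $c^{st}_u\in C^\infty(U)$ with $$[\alpha^s,\alpha^t]=\sum_{u=1}^r c^{st}_u\,\alpha^u\quad\text{on }U\qquad(s,t=1,\dots,r),$$ and these satisfy $c^{st}_u=0$ on $U$ for all $s,t$ and all $u\le q$, and $$\sum_{u=q+1}^r\frac{\partial c^{st}_u}{\partial x^i}\,b^{uj}=0\quad\text{on }U$$ for all $s,t=1,\dots,r$, all $i=1,\dots,q$ and all $j=q+1,\dots,m$. -/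

import Mathlib

open Bundle VectorField
open scoped Manifold ContDiff

noncomputable section

/-- The product `f • σ` of a smooth function and a smooth section. -/
def smulSection {m : ℕ} {M : Type*} [TopologicalSpace M]
    [ChartedSpace (EuclideanSpace ℝ (Fin m)) M]
    {F : Type*} [NormedAddCommGroup F] [NormedSpace ℝ F]
    {A : M → Type*} [TopologicalSpace (TotalSpace F A)] [∀ x, TopologicalSpace (A x)]
    [FiberBundle F A] [∀ x, AddCommGroup (A x)] [∀ x, Module ℝ (A x)] [VectorBundle ℝ F A]
    (f : C^∞⟮𝓡 m, M; ℝ⟯) (σ : Cₛ^∞⟮𝓡 m; F, A⟯) : Cₛ^∞⟮𝓡 m; F, A⟯ :=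
  ⟨fun x => f x • σ x, f.contMDiff.smul_section σ.contMDiff⟩

/-- A Lie algebroid structure on a smooth vector bundle `A → M` (with model fibre `F`) over an
`m`-dimensional smooth manifold `M`: a bundle map `anchor : A → TM` and a real Lie algebra
structure `bracket` on the space of global smooth sections, such that the anchor induces a Lie
algebra homomorphism into vector fields and the Leibniz identity holds. -/
structure LieAlgebroid (m : ℕ) (M : Type*) [TopologicalSpace M]
    [ChartedSpace (EuclideanSpace ℝ (Fin m)) M] [IsManifold (𝓡 m) ∞ M]
    (F : Type*) [NormedAddCommGroup F] [NormedSpace ℝ F]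
    (A : M → Type*) [TopologicalSpace (TotalSpace F A)] [∀ x, TopologicalSpace (A x)]
    [FiberBundle F A] [∀ x, AddCommGroup (A x)] [∀ x, Module ℝ (A x)] [VectorBundle ℝ F A] where
  /-- The anchor, fibre by fibre. -/
  anchor : ∀ x : M, A x →ₗ[ℝ] TangentSpace (𝓡 m) x
  /-- The anchor is smooth as a map of total spaces. -/
  contMDiff_anchor : ContMDiff ((𝓡 m).prod 𝓘(ℝ, F)) (𝓡 m).tangent ∞
    (fun v : TotalSpace F A => (⟨v.proj, anchor v.proj v.2⟩ : TangentBundle (𝓡 m) M))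
  /-- The Lie bracket on global smooth sections. -/
  bracket : Cₛ^∞⟮𝓡 m; F, A⟯ →ₗ[ℝ] Cₛ^∞⟮𝓡 m; F, A⟯ →ₗ[ℝ] Cₛ^∞⟮𝓡 m; F, A⟯
  bracket_self : ∀ σ, bracket σ σ = 0
  jacobi : ∀ σ τ υ,
    bracket σ (bracket τ υ) = bracket (bracket σ τ) υ + bracket τ (bracket σ υ)
  anchor_bracket : ∀ (σ τ : Cₛ^∞⟮𝓡 m; F, A⟯) (x : M),
    anchor x (bracket σ τ x) =
      mlieBracket (𝓡 m) (fun y => anchor y (σ y)) (fun y => anchor y (τ y)) x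
  leibniz : ∀ (σ τ : Cₛ^∞⟮𝓡 m; F, A⟯) (f : C^∞⟮𝓡 m, M; ℝ⟯) (x : M),
    bracket σ (smulSection f τ) x =
      f x • bracket σ τ x + mvfderiv (𝓡 m) f x (anchor x (σ x)) • τ x

/-- The `i`-th coordinate vector field of a chart `φ`: the pullback under `φ` of the constant
vector field `eᵢ`. It is meaningful on `φ.source`. -/
def coordVec {m : ℕ} {M : Type*} [TopologicalSpace M]
    [ChartedSpace (EuclideanSpace ℝ (Fin m)) M]
    (φ : OpenPartialHomeomorph M (EuclideanSpace ℝ (Fin m))) (i : Fin m) (p : M) :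
    TangentSpace (𝓡 m) p :=
  mpullback (𝓡 m) (𝓡 m) φ (fun _ => (EuclideanSpace.single i (1 : ℝ))) p

/-- The partial derivative of `f` with respect to the `i`-th coordinate of a chart `φ`. It is
meaningful on `φ.source`. -/
def coordDeriv {m : ℕ} {M : Type*} [TopologicalSpace M]
    (φ : OpenPartialHomeomorph M (EuclideanSpace ℝ (Fin m))) (i : Fin m) (f : M → ℝ) (p : M) :
    ℝ :=
  fderiv ℝ (f ∘ φ.symm) (φ p) (EuclideanSpace.single i (1 : ℝ))

end

/-! In a suitable chart and trivialization at `x₀` the anchor is a smooth family of linear maps X(z)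
: U × V' → U × W with X(0)(u, v') = (u, 0) and dim U = q. The homomorphism property of the anchor
becomes involutivity, DX(X v)w − DX(X w)v = X(c(v, w)), where c is the bracket in the
trivialization.

All q directions are straightened at once. Let ψ(u, w) be the time-one point of the integral curve
of z ↦ X(z)(u, 0) that starts at (0, w). Its differential at 0 is the identity, so its local inverse
gives the new coordinates. A derivative of ψ solves the variational equation along the curve. If g'
= κ − c(u, g) along the same curve, involutivity shows that X(z)(g) solves this equation too.
Matching initial values gives X(ψ p)(g p v) = Dψ_p(v₁, b(w) v'), where b(w) is computed on the
transversal {0} × W and hence depends on the y's only (`transport_integralEq`, `exists_transport`,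
`exists_analytic_splitting`). Smooth dependence on p follows from the inverse function theorem in
C([0,1], S), near u = 0 where the equation is trivial (`exists_contDiffOn_integralEq`).

For the structure functions, the anchored frame has constant x-components and coefficients depending
on y only. So brackets of these fields have zero x-components, which are exactly the c_u with u ≤ q,
and are independent of x. Differentiating the sum of c_u b^{uj} along x gives the last identity
(`LieAlgebroid.exists_structure_functions`). -/

section Analysis

open Set Filter Topology

/-! ### Inverse functions and cutoffs. -/

/-- The inverse function theorem for maps which are smooth on an open set: there is a local inverse
which is smooth on an open set. -/
theorem exists_openPartialHomeomorph_contDiffOn {E F : Type*}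
    [NormedAddCommGroup E] [NormedSpace ℝ E] [CompleteSpace E]
    [NormedAddCommGroup F] [NormedSpace ℝ F]
    {f : E → F} {N : Set E} (hN : IsOpen N) (hf : ContDiffOn ℝ ∞ f N) {a : E} (ha : a ∈ N)
    (f' : E ≃L[ℝ] F) (hf' : HasFDerivAt f (f' : E →L[ℝ] F) a) :
    ∃ e : OpenPartialHomeomorph E F, a ∈ e.source ∧ e.source ⊆ N ∧ ⇑e = f ∧
      ContDiffOn ℝ ∞ e.symm e.target ∧
      ∀ x ∈ e.source, ∃ g : E ≃L[ℝ] F, HasFDerivAt f (g : E →L[ℝ] F) x := by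
  have hne : (∞ : WithTop ℕ∞) ≠ 0 := by simp
  have hfa : ContDiffAt ℝ ∞ f a := hf.contDiffAt (hN.mem_nhds ha)
  let e₀ := hfa.toOpenPartialHomeomorph f hf' hne
  -- Restricting to the open set where the derivative is invertible makes the inverse smooth on the
  -- whole target and not only at `f a`.
  let R : Set (E →L[ℝ] F) := range ((↑) : (E ≃L[ℝ] F) → E →L[ℝ] F)
  have hR : IsOpen R := ContinuousLinearEquiv.isOpen
  have hcont : ContinuousOn (fderiv ℝ f) N := hf.continuousOn_fderiv_of_isOpen hN (by simp)
  have hS : IsOpen (N ∩ fderiv ℝ f ⁻¹' R) := hcont.isOpen_inter_preimage hN hR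
  let e := e₀.restrOpen _ hS
  have hinv : ∀ x ∈ e.source, ∃ g : E ≃L[ℝ] F, HasFDerivAt f (g : E →L[ℝ] F) x := by
    rintro x ⟨-, hxN, g, hg⟩
    refine ⟨g, ?_⟩
    rw [hg]
    exact ((hf.contDiffAt (hN.mem_nhds hxN)).differentiableAt hne).hasFDerivAt
  refine ⟨e, ⟨hfa.mem_toOpenPartialHomeomorph_source hf' hne, ha, f', hf'.fderiv.symm⟩,
    fun x hx => hx.2.1, rfl, ?_, hinv⟩
  intro y hy
  have hys := e.map_target hy
  obtain ⟨g, hg⟩ := hinv _ hys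
  exact (e.contDiffAt_symm hy hg (hf.contDiffAt (hN.mem_nhds hys.2.1))).contDiffWithinAt

/-- A function which is smooth on a neighbourhood of a point agrees near this point with a globally
smooth one. -/
theorem exists_contDiff_eventuallyEq {E F : Type*}
    [NormedAddCommGroup E] [NormedSpace ℝ E] [FiniteDimensional ℝ E]
    [NormedAddCommGroup F] [NormedSpace ℝ F]
    {f : E → F} {N : Set E} (hN : IsOpen N) (hf : ContDiffOn ℝ ∞ f N) {a : E} (ha : a ∈ N) :
    ∃ g : E → F, ContDiff ℝ ∞ g ∧ g =ᶠ[𝓝 a] f := by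
  obtain ⟨ε, hε, hball⟩ := Metric.nhds_basis_closedBall.mem_iff.1 (hN.mem_nhds ha)
  let ρ : ContDiffBump a := ⟨ε / 2, ε, by positivity, by linarith⟩
  refine ⟨fun x => ρ x • f x, ?_, ?_⟩
  · rw [contDiff_iff_contDiffAt]
    intro x
    by_cases hx : x ∈ N
    · exact ρ.contDiff.contDiffAt.smul (hf.contDiffAt (hN.mem_nhds hx))
    · have hx' : x ∈ (tsupport ρ)ᶜ := by
        rw [ρ.tsupport_eq]
        exact fun h => hx (hball h)
      refine (contDiffAt_const (c := (0 : F))).congr_of_eventuallyEq ?_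
      filter_upwards [(isClosed_tsupport ρ).isOpen_compl.mem_nhds hx'] with y hy
      simp [image_eq_zero_of_notMem_tsupport hy]
  · filter_upwards [ρ.eventuallyEq_one] with x hx
    simp [hx]

/-! ### Smoothness of superposition operators on spaces of continuous maps. -/

section Superposition

variable {K : Type} [TopologicalSpace K] [CompactSpace K]
  {E F G : Type} [NormedAddCommGroup E] [NormedSpace ℝ E] [NormedAddCommGroup F] [NormedSpace ℝ F]
  [NormedAddCommGroup G] [NormedSpace ℝ G]

/-- The pointwise application of a bilinear map to two continuous functions. -/
noncomputable def pointwiseApply (B : G →L[ℝ] E →L[ℝ] F) : C(K, G) →L[ℝ] C(K, E) →L[ℝ] C(K, F) :=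
  LinearMap.mkContinuous₂
    (LinearMap.mk₂ ℝ (fun (A : C(K, G)) (h : C(K, E)) =>
      (⟨fun t => B (A t) (h t), by fun_prop⟩ : C(K, F)))
      (fun _ _ _ => by ext; simp) (fun _ _ _ => by ext; simp)
      (fun _ _ _ => by ext; simp) (fun _ _ _ => by ext; simp)) ‖B‖
    (fun A h => by
      rw [ContinuousMap.norm_le _ (by positivity)]
      intro t
      exact B.le_of_opNorm₂_le_of_le le_rfl (A.norm_coe_le_norm t) (h.norm_coe_le_norm t))

/-- The superposition operator `γ ↦ f ∘ γ` is differentiable if `f` is continuously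
differentiable. -/
theorem hasFDerivAt_comp_continuousMap (B : G →L[ℝ] E →L[ℝ] F) (f : C(E, F)) (f' : C(E, G))
    (hf : ∀ x, HasFDerivAt f (B (f' x)) x) (γ : C(K, E)) :
    HasFDerivAt (fun γ : C(K, E) => f.comp γ) (pointwiseApply B (f'.comp γ)) γ := by
  rw [hasFDerivAt_iff_isLittleO, Asymptotics.isLittleO_iff]
  intro ε hε
  have hcont : Continuous (fun γ : C(K, E) => f'.comp γ) := f'.continuous_postcomp
  obtain ⟨δ, hδ, hball⟩ := Metric.continuousAt_iff.1 (hcont.continuousAt (x := γ))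
    (ε / (‖B‖ + 1)) (by positivity)
  filter_upwards [Metric.ball_mem_nhds γ hδ] with η hη
  rw [ContinuousMap.norm_le _ (by positivity)]
  intro t
  have hle : ∀ y ∈ Metric.ball (γ t) δ, ‖B (f' y) - B (f' (γ t))‖ ≤ ε := by
    intro y hy
    -- The shifted curve takes the value `y` at `t` and stays within δ of γ. Sup-norm continuity of
    -- post-composition with `f'` thus bounds `f' y - f' (γ t)` uniformly in `t`, and the mean value
    -- inequality on the ball concludes.
    have h1 : dist (γ + ContinuousMap.const K (y - γ t)) γ < δ := by
      rw [dist_eq_norm, add_sub_cancel_left]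
      refine lt_of_le_of_lt ((ContinuousMap.norm_le _ (norm_nonneg (y - γ t))).2
        fun _ => le_rfl) ?_
      rwa [← dist_eq_norm]
    have h2 := (ContinuousMap.dist_apply_le_dist t).trans (hball h1).le
    rw [dist_eq_norm] at h2
    have h3 : ‖f' y - f' (γ t)‖ ≤ ε / (‖B‖ + 1) := by simpa using h2
    rw [← map_sub]
    refine (B.le_opNorm_of_le h3).trans ?_
    rw [mul_div_assoc', div_le_iff₀ (by positivity)]
    nlinarith [norm_nonneg B]
  have hηt : η t ∈ Metric.ball (γ t) δ :=
    lt_of_le_of_lt (ContinuousMap.dist_apply_le_dist t) hη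
  have := (convex_ball (γ t) δ).norm_image_sub_le_of_norm_hasFDerivWithin_le'
    (fun x _ => (hf x).hasFDerivWithinAt) hle (Metric.mem_ball_self hδ) hηt
  refine this.trans ?_
  gcongr
  exact (η - γ).norm_coe_le_norm t

/-- The derivative of a superposition operator is again a superposition operator followed by a
continuous linear map; this drives the induction on the order of differentiability. -/
theorem contDiff_succ_comp_continuousMap (B : G →L[ℝ] E →L[ℝ] F) (f : C(E, F)) (f' : C(E, G))
    (hf : ∀ x, HasFDerivAt f (B (f' x)) x) {n : ℕ}
    (hf' : ContDiff ℝ n (fun γ : C(K, E) => f'.comp γ)) :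
    ContDiff ℝ (n + 1) (fun γ : C(K, E) => f.comp γ) :=
  contDiff_succ_iff_hasFDerivAt.2 ⟨fun γ => pointwiseApply B (f'.comp γ),
    (pointwiseApply (K := K) B).contDiff.comp hf', hasFDerivAt_comp_continuousMap B f f' hf⟩

/-- The superposition operator `γ ↦ f ∘ γ` is smooth if `f` is. -/
theorem contDiff_comp_continuousMap (f : C(E, F)) (hf : ContDiff ℝ ∞ f) :
    ContDiff ℝ ∞ (fun γ : C(K, E) => f.comp γ) := by
  rw [contDiff_infty]
  intro n
  induction n generalizing F with
  | zero => exact contDiff_zero.2 f.continuous_postcomp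
  | succ n ih =>
    exact contDiff_succ_comp_continuousMap (ContinuousLinearMap.id ℝ (E →L[ℝ] F)) f
      ⟨fderiv ℝ f, hf.continuous_fderiv (by simp)⟩
      (fun x => (hf.differentiable (by simp) x).hasFDerivAt) (ih _ (hf.fderiv_right (by simp)))

end Superposition

/-! ### Smooth dependence of solutions of differential equations on parameters. -/

section Volterra

open intervalIntegral

variable {S : Type} [NormedAddCommGroup S] [NormedSpace ℝ S] [CompleteSpace S]

/-- Clamping the time by `projIcc` extends the integrand continuously to ℝ, so primitives have
two-sided derivatives even at the endpoints of [0, 1]. -/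
theorem continuous_projIcc_comp {S : Type} [TopologicalSpace S] (f : C(Icc (0 : ℝ) 1, S)) :
    Continuous fun s : ℝ => f (projIcc 0 1 zero_le_one s) :=
  f.continuous.comp continuous_projIcc

theorem hasDerivAt_integral_projIcc (f : C(Icc (0 : ℝ) 1, S)) (τ : ℝ) :
    HasDerivAt (fun τ : ℝ => ∫ s in (0 : ℝ)..τ, f (projIcc 0 1 zero_le_one s))
      (f (projIcc 0 1 zero_le_one τ)) τ :=
  integral_hasDerivAt_right ((continuous_projIcc_comp f).intervalIntegrable _ _)
    ((continuous_projIcc_comp f).stronglyMeasurableAtFilter _ _) (continuous_projIcc_comp f).continuousAt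

/-- The primitive vanishing at `0` of a continuous function on `[0, 1]`. -/
noncomputable def primitive : C(Icc (0 : ℝ) 1, S) →L[ℝ] C(Icc (0 : ℝ) 1, S) :=
  LinearMap.mkContinuous
    { toFun := fun f => ⟨fun t => ∫ s in (0 : ℝ)..t, f (projIcc 0 1 zero_le_one s),
        (continuous_iff_continuousAt.2 fun τ =>
          (hasDerivAt_integral_projIcc f τ).continuousAt).comp continuous_subtype_val⟩
      map_add' := fun f g => by
        ext t
        exact integral_add ((continuous_projIcc_comp f).intervalIntegrable _ _)
          ((continuous_projIcc_comp g).intervalIntegrable _ _)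
      map_smul' := fun c f => by
        ext t
        exact integral_smul c _ } 1
    (fun f => by
      rw [ContinuousMap.norm_le _ (by positivity)]
      intro t
      have h := norm_integral_le_of_norm_le_const (a := 0) (b := (t : ℝ))
        (f := fun s => f (projIcc 0 1 zero_le_one s)) (C := ‖f‖)
        (fun s _ => f.norm_coe_le_norm _)
      refine h.trans ?_
      have h1 := t.2.1
      have h2 := t.2.2
      rw [sub_zero, abs_of_nonneg h1, one_mul]
      exact mul_le_of_le_one_right (norm_nonneg f) h2)

theorem primitive_apply (f : C(Icc (0 : ℝ) 1, S)) (t : Icc (0 : ℝ) 1) :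
    primitive f t = ∫ s in (0 : ℝ)..t, f (projIcc 0 1 zero_le_one s) := rfl

theorem norm_primitive_le (f : C(Icc (0 : ℝ) 1, S)) : ‖primitive f‖ ≤ ‖f‖ := by
  simpa using (primitive (S := S)).le_of_opNorm_le
    (LinearMap.mkContinuous_norm_le _ zero_le_one _) f

@[simp] theorem primitive_const (a : S) (t : Icc (0 : ℝ) 1) :
    primitive (ContinuousMap.const _ a) t = (t : ℝ) • a := by
  simp [primitive_apply]

theorem primitive_eq_sub {y : ℝ → S} {f : C(Icc (0 : ℝ) 1, S)}
    (h : ∀ t : Icc (0 : ℝ) 1, HasDerivAt y (f t) t) (t : Icc (0 : ℝ) 1) :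
    primitive f t = y t - y 0 := by
  rw [primitive_apply]
  refine integral_eq_sub_of_hasDerivAt ?_ ((continuous_projIcc_comp f).intervalIntegrable _ _)
  intro s hs
  rw [uIcc_of_le t.2.1] at hs
  have hs' : s ∈ Icc (0 : ℝ) 1 := ⟨hs.1, hs.2.trans t.2.2⟩
  rw [projIcc_of_mem _ hs']
  exact h ⟨s, hs'⟩

/-- Solutions on `[0, 1]` of an ordinary differential equation whose right-hand side depends
smoothly on a parameter `p`, and does not depend on the state for `p = p₀`, depend smoothly on
`p` near `p₀`. -/
theorem exists_contDiffOn_integralEq {P : Type} [NormedAddCommGroup P] [NormedSpace ℝ P]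
    [CompleteSpace P] (f : C(P × S, S)) (hf : ContDiff ℝ ∞ f) {s₀ : P → S} (hs₀ : ContDiff ℝ ∞ s₀)
    {p₀ : P} {a : S} (ha : ∀ s, f (p₀, s) = a) :
    ∃ (Γ : P → C(Icc (0 : ℝ) 1, S)) (N : Set P), IsOpen N ∧ p₀ ∈ N ∧ ContDiffOn ℝ ∞ Γ N ∧
      Γ p₀ = ContinuousMap.const _ (s₀ p₀) + primitive (ContinuousMap.const _ a) ∧
      ∀ p ∈ N, Γ p = ContinuousMap.const _ (s₀ p) +
        primitive (f.comp ((ContinuousMap.const _ p).prodMk (Γ p))) := by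
  let C := C(Icc (0 : ℝ) 1, S)
  let cst : S →L[ℝ] C := LinearMap.mkContinuous
    { toFun := fun s => ContinuousMap.const _ s
      map_add' := fun _ _ => rfl
      map_smul' := fun _ _ => rfl } 1
    (fun s => by
      rw [one_mul]; exact (ContinuousMap.norm_le _ (norm_nonneg s)).2 fun _ => le_rfl)
  let pair : P × C →L[ℝ] C(Icc (0 : ℝ) 1, P × S) := LinearMap.mkContinuous
    { toFun := fun x => (ContinuousMap.const _ x.1).prodMk x.2
      map_add' := fun _ _ => rfl
      map_smul' := fun _ _ => rfl } 1
    (fun x => by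
      rw [one_mul]
      refine (ContinuousMap.norm_le _ (norm_nonneg x)).2 fun t => ?_
      exact max_le (le_max_left _ _) ((x.2.norm_coe_le_norm t).trans (le_max_right _ _)))
  -- `Φ (p, γ) = (p, 0)` says exactly that γ solves the integral equation with parameter `p`, so the
  -- solution is read off from a local inverse of Φ.
  let Φ : P × C → P × C := fun x => (x.1, x.2 - cst (s₀ x.1) - primitive (f.comp (pair x)))
  have hΦ : ContDiff ℝ ∞ Φ := by
    refine contDiff_fst.prodMk ((contDiff_snd.sub (cst.contDiff.comp (hs₀.comp contDiff_fst))).sub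
      ((primitive (S := S)).contDiff.comp ((contDiff_comp_continuousMap f hf).comp pair.contDiff)))
  let γ₀ : C := cst (s₀ p₀) + primitive (ContinuousMap.const _ a)
  have hp₀ : ∀ γ : C, f.comp (pair (p₀, γ)) = ContinuousMap.const _ a := by
    intro γ; ext t; exact ha _
  -- At `p₀` the integrand ignores the state, so Φ is a translation in γ. Its differential is
  -- therefore block triangular with identity diagonal blocks, hence invertible.
  have hΦ₀ : ∀ γ : C, Φ (p₀, γ) = (p₀, γ - γ₀) := by
    intro γ
    simp only [Φ, hp₀, γ₀]
    rw [sub_sub]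
  have hA := (hΦ.differentiable (by simp) (p₀, γ₀)).hasFDerivAt
  set A := fderiv ℝ Φ (p₀, γ₀) with hAdef
  have hA1 : ∀ x, (A x).1 = x.1 := by
    have h1 := hA.fst
    have h2 : HasFDerivAt (fun x : P × C => (Φ x).1) (ContinuousLinearMap.fst ℝ P C) (p₀, γ₀) :=
      hasFDerivAt_fst
    intro x
    exact congrArg (fun T : P × C →L[ℝ] P => T x) (h1.unique h2)
  have hA2 : ∀ γ : C, A (0, γ) = (0, γ) := by
    have h1 : HasFDerivAt (fun γ : C => Φ (p₀, γ)) (A.comp (ContinuousLinearMap.inr ℝ P C)) γ₀ :=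
      hA.comp γ₀ (hasFDerivAt_prodMk_right p₀ γ₀)
    have h2 : HasFDerivAt (fun γ : C => Φ (p₀, γ)) (ContinuousLinearMap.inr ℝ P C) γ₀ := by
      simp_rw [hΦ₀]
      exact (hasFDerivAt_const p₀ γ₀).prodMk ((hasFDerivAt_id γ₀).sub_const γ₀)
    intro γ
    exact congrArg (fun T : C →L[ℝ] P × C => T γ) (h1.unique h2)
  have hA3 : ∀ x, A x = (x.1, x.2 + (A (x.1, 0)).2) := by
    intro x
    have : A x = A (x.1, 0) + A (0, x.2) := by rw [← map_add]; simp
    rw [this, hA2]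
    ext1
    · simp [hA1]
    · simp [add_comm]
  let A' : (P × C) ≃L[ℝ] P × C := ContinuousLinearEquiv.equivOfInverse A
    ((ContinuousLinearMap.fst ℝ P C).prod (ContinuousLinearMap.snd ℝ P C -
      (ContinuousLinearMap.snd ℝ P C).comp (A.comp ((ContinuousLinearMap.inl ℝ P C).comp
        (ContinuousLinearMap.fst ℝ P C)))))
    (fun x => by rw [hA3 x]; simp)
    (fun x => by rw [hA3]; simp)
  obtain ⟨e, hes, -, heq, hsymm, -⟩ := exists_openPartialHomeomorph_contDiffOn isOpen_univ
    hΦ.contDiffOn (mem_univ (p₀, γ₀)) A' hA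
  have hιc : ContDiff ℝ ∞ (fun p : P => (p, (0 : C))) := contDiff_id.prodMk contDiff_const
  refine ⟨fun p => (e.symm (p, 0)).2, (fun p => (p, (0 : C))) ⁻¹' e.target,
    e.open_target.preimage hιc.continuous, ?_, ?_, ?_, ?_⟩
  · have := e.map_source hes
    rw [heq, hΦ₀, sub_self] at this
    exact this
  · exact contDiff_snd.comp_contDiffOn (hsymm.comp hιc.contDiffOn fun _ h => h)
  · have := e.left_inv hes
    rw [heq, hΦ₀, sub_self] at this
    simp only [this]
    rfl
  · intro p hp
    have h := e.right_inv hp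
    rw [heq] at h
    have h1 : (e.symm (p, 0)).1 = p := congrArg Prod.fst h
    have h2 := congrArg Prod.snd h
    simp only [Φ] at h2
    rw [h1, sub_sub, sub_eq_zero] at h2
    have h3 : e.symm (p, 0) = (p, (e.symm (p, 0)).2) := Prod.ext h1 rfl
    rw [h3] at h2
    exact h2

end Volterra

end Analysis

/-! ### Variational equations and the splitting on vector spaces. -/

section Splitting

open Set Filter Topology

section IntegralEquation

variable {P S S' : Type} [NormedAddCommGroup P] [NormedSpace ℝ P]
  [NormedAddCommGroup S] [NormedSpace ℝ S] [CompleteSpace S]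
  [NormedAddCommGroup S'] [NormedSpace ℝ S'] [CompleteSpace S']

theorem primitive_comp_apply (L : S →L[ℝ] S') {f : C(Icc (0 : ℝ) 1, S)} {g : C(Icc (0 : ℝ) 1, S')}
    (h : ∀ t, g t = L (f t)) (t : Icc (0 : ℝ) 1) : primitive g t = L (primitive f t) := by
  simp only [primitive_apply, h]
  exact L.intervalIntegral_comp_comm ((continuous_projIcc_comp f).intervalIntegrable _ _)

/-- Uniqueness for integral equations whose integrand is a contraction. -/
theorem eq_of_integralEq {e : S} {δ₁ δ₂ h₁ h₂ : C(Icc (0 : ℝ) 1, S)}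
    (e₁ : δ₁ = ContinuousMap.const _ e + primitive h₁)
    (e₂ : δ₂ = ContinuousMap.const _ e + primitive h₂) {κ : ℝ} (hκ0 : 0 ≤ κ) (hκ : κ < 1)
    (h : ∀ t, ‖h₁ t - h₂ t‖ ≤ κ * ‖δ₁ t - δ₂ t‖) : δ₁ = δ₂ := by
  have h1 : δ₁ - δ₂ = primitive (h₁ - h₂) := by
    rw [map_sub]
    nth_rewrite 1 [e₁, e₂]
    abel
  have h2 : ‖h₁ - h₂‖ ≤ κ * ‖δ₁ - δ₂‖ := by
    rw [ContinuousMap.norm_le _ (by positivity)]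
    intro t
    refine (h t).trans ?_
    gcongr
    exact (δ₁ - δ₂).norm_coe_le_norm t
  have h3 : ‖δ₁ - δ₂‖ ≤ κ * ‖δ₁ - δ₂‖ := by
    nth_rewrite 1 [h1]
    exact (norm_primitive_le _).trans h2
  rw [← sub_eq_zero, ← norm_eq_zero]
  nlinarith [norm_nonneg (δ₁ - δ₂)]

/-- The variational equation: the derivative in the parameter of a family of solutions of
integral equations. -/
theorem fderiv_integralEq {f : C(P × S, S)} (hf : ContDiff ℝ ∞ f) {s₀ : P → S}
    (hs₀ : ContDiff ℝ ∞ s₀) {Γ : P → C(Icc (0 : ℝ) 1, S)} {N : Set P} (hN : IsOpen N)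
    (hΓ : ContDiffOn ℝ ∞ Γ N)
    (h : ∀ p ∈ N, Γ p = ContinuousMap.const _ (s₀ p) +
      primitive (f.comp ((ContinuousMap.const _ p).prodMk (Γ p)))) {p : P} (hp : p ∈ N) (v : P) :
    ∃ η : C(Icc (0 : ℝ) 1, S), (∀ t, η t = fderiv ℝ f (p, Γ p t) (v, fderiv ℝ Γ p v t)) ∧
      fderiv ℝ Γ p v = ContinuousMap.const _ (fderiv ℝ s₀ p v) + primitive η := by
  let C := C(Icc (0 : ℝ) 1, S)
  let cst : S →L[ℝ] C := LinearMap.mkContinuous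
    { toFun := fun s => ContinuousMap.const _ s
      map_add' := fun _ _ => rfl
      map_smul' := fun _ _ => rfl } 1
    (fun s => by
      rw [one_mul]; exact (ContinuousMap.norm_le _ (norm_nonneg s)).2 fun _ => le_rfl)
  let pair : P × C →L[ℝ] C(Icc (0 : ℝ) 1, P × S) := LinearMap.mkContinuous
    { toFun := fun x => (ContinuousMap.const _ x.1).prodMk x.2
      map_add' := fun _ _ => rfl
      map_smul' := fun _ _ => rfl } 1
    (fun x => by
      rw [one_mul]
      refine (ContinuousMap.norm_le _ (norm_nonneg x)).2 fun t => ?_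
      exact max_le (le_max_left _ _) ((x.2.norm_coe_le_norm t).trans (le_max_right _ _)))
  have hD : HasFDerivAt Γ (fderiv ℝ Γ p) p :=
    ((hΓ.contDiffAt (hN.mem_nhds hp)).differentiableAt (by simp)).hasFDerivAt
  have hs : HasFDerivAt s₀ (fderiv ℝ s₀ p) p := (hs₀.differentiable (by simp) p).hasFDerivAt
  have hcomp := hasFDerivAt_comp_continuousMap (K := Icc (0 : ℝ) 1)
    (ContinuousLinearMap.id ℝ (P × S →L[ℝ] S)) f ⟨fderiv ℝ f, hf.continuous_fderiv (by simp)⟩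
      (fun x => (hf.differentiable (by simp) x).hasFDerivAt) (pair (p, Γ p))
  have hpair : HasFDerivAt (fun p => pair (p, Γ p)) _ p :=
    pair.hasFDerivAt.comp p ((hasFDerivAt_id p).prodMk hD)
  -- Both sides of the integral equation agree near `p`; uniqueness of the derivative turns this
  -- into the variational equation.
  have hR := (cst.hasFDerivAt.comp p hs).add
    ((primitive (S := S)).hasFDerivAt.comp p (hcomp.comp p hpair))
  have hR' := hR.congr_of_eventuallyEq (f₁ := Γ) (by
    filter_upwards [hN.mem_nhds hp] with x hx
    exact h x hx)
  have := congrArg (fun T : P →L[ℝ] C => T v) (hD.unique hR')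
  exact ⟨_, fun t => rfl, this⟩

end IntegralEquation

/-- Transport of a curve `g` in the fibre along an integral curve `z` of an involutive family of
vector fields `X`: the curve `X (z t) (g t)` solves the linearised equation. -/
theorem transport_integralEq {E V : Type} [NormedAddCommGroup E] [NormedSpace ℝ E]
    [CompleteSpace E] [NormedAddCommGroup V] [NormedSpace ℝ V] [CompleteSpace V]
    {X : E → V →L[ℝ] E} (hX : ContDiff ℝ ∞ X) {c : E → V →L[ℝ] V →L[ℝ] V}
    {z : C(Icc (0 : ℝ) 1, E)} {g : C(Icc (0 : ℝ) 1, V)} {u κ : V}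
    (hinv : ∀ t w, fderiv ℝ X (z t) (X (z t) u) w - fderiv ℝ X (z t) (X (z t) w) u =
      X (z t) (c (z t) u w))
    {z₀ : E} {hz : C(Icc (0 : ℝ) 1, E)} (hz' : ∀ t, hz t = X (z t) u)
    (ez : z = ContinuousMap.const _ z₀ + primitive hz)
    {g₀ : V} {hg : C(Icc (0 : ℝ) 1, V)} (hg' : ∀ t, hg t = κ - c (z t) u (g t))
    (eg : g = ContinuousMap.const _ g₀ + primitive hg) :
    ∃ δ η : C(Icc (0 : ℝ) 1, E), (∀ t, δ t = X (z t) (g t)) ∧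
      (∀ t, η t = fderiv ℝ X (z t) (δ t) u + X (z t) κ) ∧
      δ = ContinuousMap.const _ (X z₀ g₀) + primitive η := by
  have hX0 : Continuous X := hX.continuous
  have hX1 : Continuous (fderiv ℝ X) := hX.continuous_fderiv (by simp)
  let δ : C(Icc (0 : ℝ) 1, E) := ⟨fun t => X (z t) (g t), by fun_prop⟩
  let η : C(Icc (0 : ℝ) 1, E) := ⟨fun t => fderiv ℝ X (z t) (δ t) u + X (z t) κ, by fun_prop⟩
  refine ⟨δ, η, fun _ => rfl, fun _ => rfl, ?_⟩
  -- The integral formulas extend `z` and `g` to the real line, which gives two-sided derivatives at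
  -- the endpoints.
  let zz : ℝ → E := fun τ => z₀ + ∫ s in (0 : ℝ)..τ, hz (projIcc 0 1 zero_le_one s)
  let gg : ℝ → V := fun τ => g₀ + ∫ s in (0 : ℝ)..τ, hg (projIcc 0 1 zero_le_one s)
  have hzz : ∀ t : Icc (0 : ℝ) 1, zz t = z t := by
    intro t; exact (congrArg (fun γ : C(Icc (0 : ℝ) 1, E) => γ t) ez).symm
  have hgg : ∀ t : Icc (0 : ℝ) 1, gg t = g t := by
    intro t; exact (congrArg (fun γ : C(Icc (0 : ℝ) 1, V) => γ t) eg).symm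
  have hder : ∀ t : Icc (0 : ℝ) 1, HasDerivAt (fun τ => X (zz τ) (gg τ)) (η t) t := by
    intro t
    have d1 : HasDerivAt zz (X (z t) u) t := by
      have := (hasDerivAt_integral_projIcc hz t).const_add z₀
      rwa [projIcc_val, hz'] at this
    have d2 : HasDerivAt gg (κ - c (z t) u (g t)) t := by
      have := (hasDerivAt_integral_projIcc hg t).const_add g₀
      rwa [projIcc_val, hg'] at this
    have d3 : HasDerivAt (fun τ => X (zz τ)) (fderiv ℝ X (z t) (X (z t) u)) t := by
      have hXd := (hX.differentiable (by simp) (zz t)).hasFDerivAt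
      rw [hzz] at hXd
      exact HasFDerivAt.comp_hasDerivAt_of_eq _ hXd d1 (hzz t).symm
    have d4 := d3.clm_apply d2
    rw [hzz, hgg] at d4
    convert! d4 using 1
    -- Involutivity replaces DX(X u)g − X(c(u, g)) by DX(X g)u, which removes c and leaves the
    -- linearised equation.
    have hi := hinv t (g t)
    simp only [η, δ, ContinuousMap.coe_mk, map_sub]
    rw [← hi]
    abel
  ext t
  have h1 := primitive_eq_sub hder t
  have h0 : zz 0 = z₀ ∧ gg 0 = g₀ := by simp [zz, gg]
  rw [hzz, hgg, h0.1, h0.2] at h1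
  simp [h1, δ]

/-- A complement of the kernel of `(X w) · ` depending smoothly on `w`: if `X 0` is the projection
onto the first factor, then `ker (fst ∘ X w)` is parametrised smoothly by `ker (X 0)`. -/
theorem exists_contDiff_kernel_frame {U W V' : Type}
    [NormedAddCommGroup U] [NormedSpace ℝ U] [FiniteDimensional ℝ U]
    [NormedAddCommGroup W] [NormedSpace ℝ W] [FiniteDimensional ℝ W]
    [NormedAddCommGroup V'] [NormedSpace ℝ V'] [FiniteDimensional ℝ V']
    {Y : W → U × V' →L[ℝ] U} (hY : ContDiff ℝ ∞ Y) (hY0 : ∀ v, Y 0 v = v.1) :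
    ∃ k : W → V' →L[ℝ] U × V', ContDiff ℝ ∞ k ∧ k 0 = ContinuousLinearMap.inr ℝ U V' ∧
      ∀ᶠ w in 𝓝 0, ∀ v', Y w (k w v') = 0 := by
  have : CompleteSpace U := FiniteDimensional.complete ℝ U
  let A : W → U →L[ℝ] U := fun w => (Y w).comp (ContinuousLinearMap.inl ℝ U V')
  let B : W → V' →L[ℝ] U := fun w => (Y w).comp (ContinuousLinearMap.inr ℝ U V')
  have hA : ContDiff ℝ ∞ A := hY.clm_comp contDiff_const
  have hB : ContDiff ℝ ∞ B := hY.clm_comp contDiff_const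
  have hA0 : A 0 = (ContinuousLinearEquiv.refl ℝ U : U →L[ℝ] U) := by ext u; simp [A, hY0]
  let R : Set (U →L[ℝ] U) := range ((↑) : (U ≃L[ℝ] U) → U →L[ℝ] U)
  have hR : IsOpen (A ⁻¹' R) := ContinuousLinearEquiv.isOpen.preimage hA.continuous
  have h0R : (0 : W) ∈ A ⁻¹' R := ⟨_, hA0.symm⟩
  -- The kernel of (A | B) with A invertible is the graph v' ↦ (−A⁻¹B v', v').
  let k : W → V' →L[ℝ] U × V' := fun w =>
    (ContinuousLinearMap.inl ℝ U V').comp (-((A w).inverse.comp (B w))) +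
      ContinuousLinearMap.inr ℝ U V'
  have hk : ContDiffOn ℝ ∞ k (A ⁻¹' R) := by
    have hi : ContDiffOn ℝ ∞ (fun w => (A w).inverse) (A ⁻¹' R) := by
      rintro w ⟨g, hg⟩
      have := contDiffAt_map_inverse (n := ∞) g
      rw [hg] at this
      exact (this.comp w hA.contDiffAt).contDiffWithinAt
    exact (contDiffOn_const.clm_comp (hi.clm_comp hB.contDiffOn).neg).add contDiffOn_const
  obtain ⟨k', hk', he⟩ := exists_contDiff_eventuallyEq hR hk h0R
  refine ⟨k', hk', ?_, ?_⟩
  · rw [he.self_of_nhds]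
    have hB0 : B 0 = 0 := by ext v; simp [B, hY0]
    simp [k, hB0]
  · filter_upwards [he, hR.mem_nhds h0R] with w hw hwR v'
    obtain ⟨g, hg⟩ := hwR
    rw [hw]
    have h1 : Y w (k w v') = A w (-((A w).inverse (B w v'))) + B w v' := by
      simp only [A, B, ContinuousLinearMap.comp_apply, ← map_add]
      simp [k, A, B]
    rw [h1, ← hg, ContinuousLinearMap.inverse_equiv]
    simp

/-- Integral curves `z` of an involutive family of vector fields `X` depending on a parameter `p`,
together with transport along them in a space `T` of frames. The derivative of the end point with
respect to the parameter is the image under `X` of a transported vector. -/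
theorem exists_transport {P E V T Q : Type} [NormedAddCommGroup P] [NormedSpace ℝ P]
    [CompleteSpace P] [NormedAddCommGroup E] [NormedSpace ℝ E] [CompleteSpace E]
    [NormedAddCommGroup V] [NormedSpace ℝ V] [CompleteSpace V]
    [NormedAddCommGroup T] [NormedSpace ℝ T] [CompleteSpace T]
    {X : E → V →L[ℝ] E} (hX : ContDiff ℝ ∞ X) {c : E → V →L[ℝ] V →L[ℝ] V}
    (hinv : ∀ᶠ z in 𝓝 0, ∀ v w, fderiv ℝ X z (X z v) w - fderiv ℝ X z (X z w) v =
      X z (c z v w))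
    (uP : P →L[ℝ] V) (zP : P →L[ℝ] E) {T₀ : P → T} (hT₀ : ContDiff ℝ ∞ T₀)
    (app : Q → T →L[ℝ] V) (κ : Q → V) {f₂ : P × (E × T) → T} (hf₂ : ContDiff ℝ ∞ f₂)
    (happ : ∀ p z S v, app v (f₂ (p, (z, S))) = κ v - c z (uP p) (app v S))
    {a : T} (ha : ∀ s, f₂ (0, s) = a) :
    ∃ (ψ : P → E) (g : P → T) (N : Set P), IsOpen N ∧ 0 ∈ N ∧ ContDiffOn ℝ ∞ ψ N ∧
      ContDiffOn ℝ ∞ g N ∧ ψ 0 = 0 ∧ g 0 = T₀ 0 + a ∧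
      (∀ v, fderiv ℝ ψ 0 v = zP v + X 0 (uP v)) ∧
      ∀ p ∈ N, ∀ v d, uP d = κ v → X (zP p) (app v (T₀ p)) = zP d →
        X (ψ p) (app v (g p)) = fderiv ℝ ψ p d := by
  let f₁ : P × (E × T) → E := fun x => X x.2.1 (uP x.1)
  have hu : ContDiff ℝ ∞ (fun x : P × (E × T) => uP x.1) := uP.contDiff.comp contDiff_fst
  have hz : ContDiff ℝ ∞ (fun x : P × (E × T) => x.2.1) := contDiff_fst.comp contDiff_snd
  have hf₁ : ContDiff ℝ ∞ f₁ := (hX.comp hz).clm_apply hu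
  let f : C(P × (E × T), E × T) := ⟨fun x => (f₁ x, f₂ x), (hf₁.prodMk hf₂).continuous⟩
  have hf : ContDiff ℝ ∞ f := hf₁.prodMk hf₂
  let s₀ : P → E × T := fun p => (zP p, T₀ p)
  have hs₀ : ContDiff ℝ ∞ s₀ := zP.contDiff.prodMk hT₀
  -- At parameter 0 the velocity X(z)(0) vanishes, so the right-hand side is independent of the
  -- state, as the existence result requires.
  have hf0 : ∀ s : E × T, f ((0 : P), s) = (0, a) := by
    intro s
    simp [f, f₁, ha]
  obtain ⟨Γ, N, hN, h0N, hΓ, hΓ0, hΓeq⟩ := exists_contDiffOn_integralEq f hf hs₀ hf0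
  let ev : C(Icc (0 : ℝ) 1, E × T) →L[ℝ] E × T := ContinuousMap.evalCLM ℝ 1
  let ψ : P → E := fun p => (Γ p 1).1
  let g : P → T := fun p => (Γ p 1).2
  have hev : ContDiffOn ℝ ∞ (fun p => ev (Γ p)) N := ev.contDiff.comp_contDiffOn hΓ
  have hψ : ContDiffOn ℝ ∞ ψ N := contDiff_fst.comp_contDiffOn hev
  have hg : ContDiffOn ℝ ∞ g N := contDiff_snd.comp_contDiffOn hev
  have hΓ0t : ∀ t, Γ 0 t = (0, T₀ 0 + (t : ℝ) • a) := by
    intro t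
    rw [hΓ0]
    simp [s₀]
  have hfder : ∀ (p v : P) (s s' : E × T), (fderiv ℝ f (p, s) (v, s')).1 =
      fderiv ℝ X s.1 s'.1 (uP p) + X s.1 (uP v) := by
    intro p v s s'
    have h1 : HasFDerivAt f (fderiv ℝ f (p, s)) (p, s) :=
      (hf.differentiable (by simp) _).hasFDerivAt
    have hXd := (hX.differentiable (by simp) s.1).hasFDerivAt
    have h2 : HasFDerivAt (fun x : P × (E × T) => X x.2.1) _ (p, s) :=
      hXd.comp (p, s) (hasFDerivAt_snd (p := (p, s))).fst
    have h3 : HasFDerivAt (fun x : P × (E × T) => uP x.1) _ (p, s) :=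
      uP.hasFDerivAt.comp (p, s) (hasFDerivAt_fst (p := (p, s)))
    have h4 := congrArg (fun L : P × (E × T) →L[ℝ] E => L (v, s'))
      (h1.fst.unique (h2.clm_apply h3))
    refine h4.trans ?_
    simp [add_comm]
  -- The E-component of the variational equation closes up by itself, since `f₁` does not involve
  -- the frame.
  have hΓd : ∀ p ∈ N, ∀ v : P, ∃ η : C(Icc (0 : ℝ) 1, E), ∃ δ : C(Icc (0 : ℝ) 1, E),
      δ 1 = fderiv ℝ ψ p v ∧
      (∀ t, η t = fderiv ℝ X (Γ p t).1 (δ t) (uP p) + X (Γ p t).1 (uP v)) ∧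
      δ = ContinuousMap.const _ (zP v) + primitive η := by
    intro p hp v
    obtain ⟨η, hη, heq⟩ := fderiv_integralEq hf hs₀ hN hΓ hΓeq hp v
    let fstC : C(E × T, E) := ⟨Prod.fst, continuous_fst⟩
    refine ⟨fstC.comp η, fstC.comp (fderiv ℝ Γ p v), ?_, ?_, ?_⟩
    · have hD : HasFDerivAt Γ (fderiv ℝ Γ p) p :=
        ((hΓ.contDiffAt (hN.mem_nhds hp)).differentiableAt (by simp)).hasFDerivAt
      have := (((ContinuousLinearMap.fst ℝ E T).comp ev).hasFDerivAt.comp p hD).fderiv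
      exact (congrArg (fun L : P →L[ℝ] E => L v) this).symm
    · intro t
      simp only [ContinuousMap.comp_apply, hη]
      exact hfder _ _ _ _
    · ext1 t
      have h1 := congrArg (fun γ : C(Icc (0 : ℝ) 1, E × T) => (γ t).1) heq
      have h2 : (fderiv ℝ s₀ p v).1 = zP v := by
        have h3 : HasFDerivAt s₀ (fderiv ℝ s₀ p) p :=
          (hs₀.differentiable (by simp) _).hasFDerivAt
        exact congrArg (fun L : P →L[ℝ] E => L v) (h3.fst.unique zP.hasFDerivAt)
      have h5 := primitive_comp_apply (ContinuousLinearMap.fst ℝ E T)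
        (f := η) (g := fstC.comp η) (fun _ => rfl) t
      rw [ContinuousMap.add_apply, h5, ContinuousMap.const_apply, ← h2]
      exact h1
  -- Once M‖u‖ < 1, the linearised equation is a contraction on [0, 1], which gives uniqueness
  -- directly. The parameter is also kept so small that the curves stay where involutivity holds.
  obtain ⟨M, hM⟩ : ∃ M : ℝ, ∀ᶠ z in 𝓝 (0 : E), ‖fderiv ℝ X z‖ ≤ M := by
    have hcont : ContinuousAt (fun z => ‖fderiv ℝ X z‖) (0 : E) :=
      (hX.continuous_fderiv (by simp)).norm.continuousAt
    exact ⟨‖fderiv ℝ X 0‖ + 1, (hcont.eventually_lt_const (lt_add_one _)).mono fun _ h => h.le⟩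
  obtain ⟨ε, hε, hball⟩ := Metric.eventually_nhds_iff.1 (hM.and hinv)
  have hΓc : ContinuousAt Γ 0 := (hΓ.contDiffAt (hN.mem_nhds h0N)).continuousAt
  have ev1 : ∀ᶠ p in 𝓝 (0 : P), dist (Γ p) (Γ 0) < ε := Metric.continuousAt_iff'.1 hΓc ε hε
  have ev2 : ∀ᶠ p in 𝓝 (0 : P), M * ‖uP p‖ < 1 := by
    have : ContinuousAt (fun p : P => M * ‖uP p‖) 0 := by fun_prop
    refine this.eventually_lt_const ?_
    simp
  obtain ⟨N', hN'sub, hN', h0N'⟩ := mem_nhds_iff.1 ((ev1.and ev2).and (hN.mem_nhds h0N))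
  have hsub : N' ⊆ N := fun p hp => (hN'sub hp).2
  refine ⟨ψ, g, N', hN', h0N', hψ.mono hsub, hg.mono hsub, ?_, ?_, ?_, ?_⟩
  · simp only [ψ, hΓ0t]
  · simp [g, hΓ0t]
  · intro v
    obtain ⟨η, δ, h1, h2, h3⟩ := hΓd 0 h0N v
    have hη : η = ContinuousMap.const _ (X 0 (uP v)) := by
      ext1 t
      rw [h2, hΓ0t]
      simp
    rw [← h1, h3, hη]
    simp
  · intro p hp v d hd hd'
    obtain ⟨⟨hp1, hp2⟩, hpN⟩ := hN'sub hp
    have hzt : ∀ t, dist (Γ p t).1 0 < ε := by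
      intro t
      have h1 := (ContinuousMap.dist_apply_le_dist (f := Γ p) (g := Γ 0) t).trans_lt hp1
      rw [hΓ0t] at h1
      exact (le_max_left _ _).trans_lt h1
    let fstC : C(E × T, E) := ⟨Prod.fst, continuous_fst⟩
    let appL : E × T →L[ℝ] V := (app v).comp (ContinuousLinearMap.snd ℝ E T)
    let appC : C(E × T, V) := ⟨appL, appL.continuous⟩
    let F : C(Icc (0 : ℝ) 1, E × T) := f.comp ((ContinuousMap.const _ p).prodMk (Γ p))
    have hΓp : ∀ t, Γ p t = s₀ p + primitive F t := fun t =>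
      congrArg (fun γ : C(Icc (0 : ℝ) 1, E × T) => γ t) (hΓeq p hpN)
    obtain ⟨δ₂, η₂, h₂, hη₂, hδ₂⟩ := transport_integralEq hX (c := c) (z := fstC.comp (Γ p))
      (g := appC.comp (Γ p)) (u := uP p) (κ := κ v)
      (fun t w => (hball (hzt t)).2 _ _) (z₀ := zP p) (hz := fstC.comp F) (fun t => rfl)
      (by
        ext1 t
        have h5 := primitive_comp_apply (ContinuousLinearMap.fst ℝ E T)
          (f := F) (g := fstC.comp F) (fun _ => rfl) t
        rw [ContinuousMap.add_apply, h5, ContinuousMap.comp_apply, hΓp]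
        rfl)
      (g₀ := app v (T₀ p)) (hg := appC.comp F) (fun t => happ _ _ _ _)
      (by
        ext1 t
        have h5 := primitive_comp_apply appL (f := F) (g := appC.comp F) (fun _ => rfl) t
        rw [ContinuousMap.add_apply, h5, ContinuousMap.comp_apply, hΓp]
        exact map_add appL _ _)
    obtain ⟨η₁, δ₁, h₁, hη₁, hδ₁⟩ := hΓd p hpN d
    rw [hd'] at hδ₂
    have hM0 : 0 ≤ M := (norm_nonneg (fderiv ℝ X (Γ p 0).1)).trans (hball (hzt 0)).1
    -- δ₁ ends at the derivative of ψ along `d`, δ₂ at the image under X of the transported vector;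
    -- they share equation and initial value.
    have : δ₁ = δ₂ := by
      refine eq_of_integralEq hδ₁ hδ₂ (κ := M * ‖uP p‖) (by positivity) hp2 ?_
      intro t
      rw [hη₁, hη₂, hd]
      have h6 : fderiv ℝ X (Γ p t).1 (δ₁ t) (uP p) + X (Γ p t).1 (κ v) -
          (fderiv ℝ X (Γ p t).1 (δ₂ t) (uP p) + X (Γ p t).1 (κ v)) =
          fderiv ℝ X (Γ p t).1 (δ₁ t - δ₂ t) (uP p) := by
        simp [map_sub]
      refine (le_of_eq (congrArg norm h6)).trans ?_
      have h7 := (fderiv ℝ X (Γ p t).1).le_of_opNorm_le (hball (hzt t)).1 (δ₁ t - δ₂ t)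
      refine ((fderiv ℝ X (Γ p t).1 (δ₁ t - δ₂ t)).le_of_opNorm_le h7 _).trans (le_of_eq ?_)
      ring
    rw [← h₁, this, h₂]
    rfl

/-- The analytic form of the local splitting theorem. -/
theorem exists_analytic_splitting {U W V' : Type}
    [NormedAddCommGroup U] [NormedSpace ℝ U] [FiniteDimensional ℝ U]
    [NormedAddCommGroup W] [NormedSpace ℝ W] [FiniteDimensional ℝ W]
    [NormedAddCommGroup V'] [NormedSpace ℝ V'] [FiniteDimensional ℝ V']
    {X : U × W → U × V' →L[ℝ] U × W} (hX : ContDiff ℝ ∞ X)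
    {c : U × W → U × V' →L[ℝ] U × V' →L[ℝ] U × V'} (hc : ContDiff ℝ ∞ c)
    (hinv : ∀ᶠ z in 𝓝 0, ∀ v w, fderiv ℝ X z (X z v) w - fderiv ℝ X z (X z w) v =
      X z (c z v w))
    (hX0 : ∀ v, X 0 v = (v.1, 0)) :
    ∃ (ψ : U × W → U × W) (g : U × W → U × V' →L[ℝ] U × V') (b : W → V' →L[ℝ] W)
      (N : Set (U × W)), IsOpen N ∧ 0 ∈ N ∧ ContDiffOn ℝ ∞ ψ N ∧ ContDiffOn ℝ ∞ g N ∧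
      ContDiff ℝ ∞ b ∧ ψ 0 = 0 ∧ HasFDerivAt ψ (ContinuousLinearMap.id ℝ (U × W)) 0 ∧
      g 0 = ContinuousLinearMap.id ℝ (U × V') ∧ b 0 = 0 ∧
      ∀ p ∈ N, ∀ v : U × V', X (ψ p) (g p v) = fderiv ℝ ψ p (v.1, b p.2 v.2) := by
  have : CompleteSpace U := FiniteDimensional.complete ℝ U
  have : CompleteSpace W := FiniteDimensional.complete ℝ W
  have : CompleteSpace V' := FiniteDimensional.complete ℝ V'
  -- Along the transversal {0} × W, `k w` parametrises the vectors sent by X into the W-directions;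
  -- `b w` is the resulting map into W.
  obtain ⟨k, hk, hk0, hkY⟩ := exists_contDiff_kernel_frame
    (Y := fun w => (ContinuousLinearMap.fst ℝ U W).comp (X (0, w)))
    (contDiff_const.clm_comp (hX.comp (contDiff_const.prodMk contDiff_id)))
    (fun v => congrArg Prod.fst (hX0 v))
  let b : W → V' →L[ℝ] W := fun w =>
    (ContinuousLinearMap.snd ℝ U W).comp ((X (0, w)).comp (k w))
  have hb : ContDiff ℝ ∞ b := contDiff_const.clm_comp
    ((hX.comp (contDiff_const.prodMk contDiff_id)).clm_comp hk)
  have hb0 : b 0 = 0 := by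
    ext1 v
    simp only [b, hk0]
    exact congrArg Prod.snd (hX0 (0, v))
  let incl : U →L[ℝ] U × V' := ContinuousLinearMap.inl ℝ U V'
  let uP : U × W →L[ℝ] U × V' := incl.comp (ContinuousLinearMap.fst ℝ U W)
  let zP : U × W →L[ℝ] U × W :=
    (ContinuousLinearMap.inr ℝ U W).comp (ContinuousLinearMap.snd ℝ U W)
  let pr : U × V' →L[ℝ] U × V' := incl.comp (ContinuousLinearMap.fst ℝ U V')
  -- The frame starts at 0 on U and at `k w` on V'. At p = 0 the forcing term `pr` adds the identity
  -- on U during unit time, so that g 0 = id.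
  have hT₀ : ContDiff ℝ ∞
      (fun p : U × W => (k p.2).comp (ContinuousLinearMap.snd ℝ U V')) :=
    (hk.comp contDiff_snd).clm_comp contDiff_const
  have hf₂ : ContDiff ℝ ∞ (fun x : (U × W) × ((U × W) × (U × V' →L[ℝ] U × V')) =>
      pr - (c x.2.1 (uP x.1)).comp x.2.2) := contDiff_const.sub
    (((hc.comp (contDiff_fst.comp contDiff_snd)).clm_apply
      (uP.contDiff.comp contDiff_fst)).clm_comp (contDiff_snd.comp contDiff_snd))
  obtain ⟨ψ, g, N, hN, h0N, hψ, hg, hψ0, hg0, hdψ, hmain⟩ := exists_transport hX hinv uP zP hT₀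
    (fun v => ContinuousLinearMap.apply ℝ (U × V') v) pr hf₂ (fun _ _ _ _ => rfl) (a := pr)
    (fun s => by simp)
  have ev3 : ∀ᶠ p : U × W in 𝓝 0, ∀ v', (X (0, p.2) (k p.2 v')).1 = 0 := by
    have : Tendsto (fun p : U × W => p.2) (𝓝 0) (𝓝 0) := continuous_snd.tendsto _
    exact this.eventually hkY
  obtain ⟨N', hN'sub, hN', h0N'⟩ := mem_nhds_iff.1 (ev3.and (hN.mem_nhds h0N))
  have hsub : N' ⊆ N := fun p hp => (hN'sub hp).2
  refine ⟨ψ, g, b, N', hN', h0N', hψ.mono hsub, hg.mono hsub, hb, hψ0, ?_, ?_, hb0, ?_⟩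
  · have hd : HasFDerivAt ψ (fderiv ℝ ψ 0) 0 :=
      ((hψ.contDiffAt (hN.mem_nhds h0N)).differentiableAt (by simp)).hasFDerivAt
    have : fderiv ℝ ψ 0 = ContinuousLinearMap.id ℝ (U × W) := by
      refine ContinuousLinearMap.ext fun v => ?_
      rw [hdψ, hX0]
      simp [zP, uP, incl]
    rwa [this] at hd
  · rw [hg0, Prod.snd_zero, hk0]
    refine ContinuousLinearMap.ext fun v => ?_
    simp [pr, incl]
  · intro p hp v
    obtain ⟨hp3, hpN⟩ := hN'sub hp
    -- Initial values match because X(0, w)(k w v') = (0, b w v'), its U-component being zero by the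
    -- choice of `k`.
    exact hmain p hpN v (v.1, b p.2 v.2) rfl (Prod.ext (hp3 v.2) rfl)

end Splitting

/-! ### Vector fields read in charts. -/

section VectorFieldRepresentative

open Set Filter Topology

variable {m : ℕ} {M : Type*} [TopologicalSpace M] [ChartedSpace (EuclideanSpace ℝ (Fin m)) M]
  {E : Type*} [NormedAddCommGroup E] [NormedSpace ℝ E]

/-- A local homeomorphism from a manifold to a vector space which is smooth in both directions. -/
structure IsSmoothChart (χ : OpenPartialHomeomorph M E) : Prop where
  contMDiffOn : ContMDiffOn (𝓡 m) 𝓘(ℝ, E) ∞ χ χ.source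
  contMDiffOn_symm : ContMDiffOn 𝓘(ℝ, E) (𝓡 m) ∞ χ.symm χ.target

/-- The representative in a vector space of a vector field on a manifold. -/
noncomputable def fieldRep (χ : OpenPartialHomeomorph M E) (V : ∀ p : M, TangentSpace (𝓡 m) p)
    (z : E) : E :=
  mfderiv (𝓡 m) 𝓘(ℝ, E) χ (χ.symm z) (V (χ.symm z))

variable {χ : OpenPartialHomeomorph M E}

theorem IsSmoothChart.mdifferentiable (hχ : IsSmoothChart (m := m) χ) :
    χ.MDifferentiable (𝓡 m) 𝓘(ℝ, E) :=
  ⟨hχ.contMDiffOn.mdifferentiableOn (by simp), hχ.contMDiffOn_symm.mdifferentiableOn (by simp)⟩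

theorem IsSmoothChart.contMDiffAt (hχ : IsSmoothChart (m := m) χ) {p : M} (hp : p ∈ χ.source) :
    ContMDiffAt (𝓡 m) 𝓘(ℝ, E) ∞ χ p :=
  hχ.contMDiffOn.contMDiffAt (χ.open_source.mem_nhds hp)

theorem IsSmoothChart.contMDiffAt_symm (hχ : IsSmoothChart (m := m) χ) {z : E}
    (hz : z ∈ χ.target) : ContMDiffAt 𝓘(ℝ, E) (𝓡 m) ∞ χ.symm z :=
  hχ.contMDiffOn_symm.contMDiffAt (χ.open_target.mem_nhds hz)

theorem IsSmoothChart.mfderiv_injective (hχ : IsSmoothChart (m := m) χ) {p : M}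
    (hp : p ∈ χ.source) : Function.Injective (mfderiv (𝓡 m) 𝓘(ℝ, E) χ p) :=
  (hχ.mdifferentiable.mfderiv hp).injective

/-- This gives access to smoothness of pullbacks and their compatibility with brackets, while
`fieldRep` itself stays visibly linear in the field. -/
theorem IsSmoothChart.fieldRep_eq_mpullback (hχ : IsSmoothChart (m := m) χ)
    (V : ∀ p : M, TangentSpace (𝓡 m) p) {z : E} (hz : z ∈ χ.target) :
    fieldRep χ V z = mpullback 𝓘(ℝ, E) (𝓡 m) χ.symm V z := by
  have h := hχ.mdifferentiable
  have h1 : (h.symm.mfderiv hz : TangentSpace 𝓘(ℝ, E) z →L[ℝ] TangentSpace (𝓡 m) (χ.symm z)) =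
      mfderiv 𝓘(ℝ, E) (𝓡 m) χ.symm z := rfl
  rw [mpullback_apply, ← h1, ContinuousLinearMap.inverse_equiv]
  rfl

theorem IsSmoothChart.contDiffOn_fieldRep [IsManifold (𝓡 m) ∞ M] [CompleteSpace E]
    (hχ : IsSmoothChart (m := m) χ) {V : ∀ p : M, TangentSpace (𝓡 m) p}
    (hV : ContMDiff (𝓡 m) (𝓡 m).tangent ∞ (fun p => (V p : TangentBundle (𝓡 m) M))) :
    ContDiffOn ℝ ∞ (fieldRep χ V) χ.target := by
  have : IsManifold (𝓡 m) 1 M := IsManifold.of_le (n := ∞) (by simp)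
  have h : ContDiffOn ℝ ∞ (fun z => mpullback 𝓘(ℝ, E) (𝓡 m) χ.symm V z) χ.target := by
    refine contMDiffOn_vectorSpace_iff_contDiffOn.1 fun z hz => ?_
    have h1 := ContMDiffWithinAt.mpullback_vectorField_preimage (t := univ) (m := ∞) (n := ∞)
      (hV.contMDiffAt (x := χ.symm z)).contMDiffWithinAt (hχ.contMDiffAt_symm hz)
      ⟨hχ.mdifferentiable.symm.mfderiv hz, rfl⟩ (by simp)
    exact h1.mono (subset_univ _)
  exact h.congr fun z hz => hχ.fieldRep_eq_mpullback V hz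

theorem IsSmoothChart.lieBracket_fieldRep [IsManifold (𝓡 m) ∞ M] [CompleteSpace E]
    (hχ : IsSmoothChart (m := m) χ)
    {V W : ∀ p : M, TangentSpace (𝓡 m) p}
    (hV : ContMDiff (𝓡 m) (𝓡 m).tangent ∞ (fun p => (V p : TangentBundle (𝓡 m) M)))
    (hW : ContMDiff (𝓡 m) (𝓡 m).tangent ∞ (fun p => (W p : TangentBundle (𝓡 m) M)))
    {z : E} (hz : z ∈ χ.target) :
    lieBracket ℝ (fieldRep χ V) (fieldRep χ W) z = fieldRep χ (mlieBracket (𝓡 m) V W) z := by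
  have h2 : minSmoothness ℝ 2 ≤ ∞ := by
    rw [minSmoothness_of_isRCLikeNormedField]; exact ENat.LEInfty.out
  have : IsManifold (𝓡 m) (minSmoothness ℝ 2) M := IsManifold.of_le (n := ∞) h2
  rw [hχ.fieldRep_eq_mpullback _ hz, mpullback_mlieBracket (n := ∞)
    (hV.contMDiffAt.mdifferentiableAt (by simp)) (hW.contMDiffAt.mdifferentiableAt (by simp))
    (hχ.contMDiffAt_symm hz) h2, ← mlieBracketWithin_univ, mlieBracketWithin_eq_lieBracketWithin]
  have key : ∀ V : ∀ p : M, TangentSpace (𝓡 m) p,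
      fieldRep χ V =ᶠ[𝓝 z] (mpullback 𝓘(ℝ, E) (𝓡 m) χ.symm V : E → E) := by
    intro V
    filter_upwards [χ.open_target.mem_nhds hz] with y hy
    exact hχ.fieldRep_eq_mpullback _ hy
  refine ((key V).lieBracket_vectorField_eq (key W)).trans ?_
  exact congrFun lieBracketWithin_univ.symm z

theorem mfderiv_coordVec {φ : OpenPartialHomeomorph M (EuclideanSpace ℝ (Fin m))}
    (hφ : IsSmoothChart (m := m) φ) {p : M} (hp : p ∈ φ.source) (j : Fin m) :
    mfderiv (𝓡 m) (𝓡 m) φ p (coordVec φ j p) = EuclideanSpace.single j (1 : ℝ) := by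
  let D := hφ.mdifferentiable.mfderiv hp
  have h1 : (D : TangentSpace (𝓡 m) p →L[ℝ] TangentSpace (𝓡 m) (φ p)).inverse = D.symm :=
    ContinuousLinearMap.inverse_equiv D
  have h2 : coordVec φ j p = D.symm (EuclideanSpace.single j (1 : ℝ)) :=
    congrArg (fun T : TangentSpace (𝓡 m) (φ p) →L[ℝ] TangentSpace (𝓡 m) p =>
      T (EuclideanSpace.single j (1 : ℝ))) h1
  rw [h2]
  exact D.apply_symm_apply _

end VectorFieldRepresentative

/-! ### Structure functions of the bracket in a splitting frame. -/

section StructureFunctions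

open Set Filter Topology

/-- The coefficients of a smooth section in a smooth local frame are smooth. -/
theorem IsLocalFrameOn.contMDiffOn_coeff_section {m : ℕ} {M : Type*} [TopologicalSpace M]
    [ChartedSpace (EuclideanSpace ℝ (Fin m)) M] [IsManifold (𝓡 m) ∞ M]
    {F : Type*} [NormedAddCommGroup F] [NormedSpace ℝ F] [FiniteDimensional ℝ F]
    {A : M → Type*} [TopologicalSpace (TotalSpace F A)] [∀ x, TopologicalSpace (A x)]
    [FiberBundle F A] [∀ x, AddCommGroup (A x)] [∀ x, Module ℝ (A x)] [VectorBundle ℝ F A]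
    [ContMDiffVectorBundle ∞ F A (𝓡 m)] {ι : Type*} [Fintype ι]
    {α : ι → (x : M) → A x} {u : Set M} (hα : IsLocalFrameOn (𝓡 m) F ∞ α u) (hu : IsOpen u)
    (σ : Cₛ^∞⟮𝓡 m; F, A⟯) (i : ι) :
    ContMDiffOn (𝓡 m) 𝓘(ℝ, ℝ) ∞ (fun p => hα.coeff i p (σ p)) u := by
  intro x hx
  let e := trivializationAt F A x
  have hxe : x ∈ e.baseSet := FiberBundle.mem_baseSet_trivializationAt F A x
  -- `H y` sends frame coefficients to the fibre coordinate in the trivialization. It is invertible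
  -- on the common domain, and smoothness of inversion makes the coefficients smooth.
  let H : M → (ι → ℝ) →L[ℝ] F := fun y =>
    ∑ s, (ContinuousLinearMap.proj (R := ℝ) (φ := fun _ : ι => ℝ) s).smulRight (e ⟨y, α s y⟩).2
  have hHeq : ∀ y (hyu : y ∈ u) (hye : y ∈ e.baseSet),
      ((((hα.toBasisAt hyu).equivFun.symm.trans (e.linearEquivAt ℝ y hye)).toContinuousLinearEquiv :
        (ι → ℝ) ≃L[ℝ] F) : (ι → ℝ) →L[ℝ] F) = H y := by
    intro y hyu hye
    refine ContinuousLinearMap.ext fun a => ?_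
    have : e.linearEquivAt ℝ y hye ((hα.toBasisAt hyu).equivFun.symm a) = H y a := by
      rw [Module.Basis.equivFun_symm_apply, map_sum]
      simp [H, Trivialization.linearEquivAt_apply]
    exact this
  have hH : ContMDiffAt (𝓡 m) 𝓘(ℝ, (ι → ℝ) →L[ℝ] F) ∞ H x := by
    refine ContMDiffAt.sum fun s _ => ?_
    have h1 : ContMDiffAt (𝓡 m) 𝓘(ℝ, F) ∞ (fun y => (e ⟨y, α s y⟩).2) x :=
      (e.contMDiffAt_section_iff hxe).1 (hα.contMDiffAt hu hx s)
    exact ((ContinuousLinearMap.smulRightL ℝ (ι → ℝ) F (ContinuousLinearMap.proj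
      (R := ℝ) (φ := fun _ : ι => ℝ) s)).contDiff.contMDiff).contMDiffAt.comp x h1
  have hσ : ContMDiffAt (𝓡 m) 𝓘(ℝ, F) ∞ (fun y => (e ⟨y, σ y⟩).2) x :=
    (e.contMDiffAt_section_iff hxe).1 σ.contMDiff.contMDiffAt
  have hinv : ContMDiffAt (𝓡 m) 𝓘(ℝ, F →L[ℝ] (ι → ℝ)) ∞ (fun y => (H y).inverse) x := by
    have h2 := contDiffAt_map_inverse (n := ∞) (𝕜 := ℝ)
      ((hα.toBasisAt hx).equivFun.symm.trans (e.linearEquivAt ℝ x hxe)).toContinuousLinearEquiv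
    rw [hHeq x hx hxe] at h2
    exact h2.contMDiffAt.comp x hH
  have hfin : ContMDiffAt (𝓡 m) 𝓘(ℝ, ι → ℝ) ∞ (fun y => (H y).inverse (e ⟨y, σ y⟩).2) x :=
    hinv.clm_apply hσ
  have hfin' := (contMDiffAt_pi_space.1 hfin) i
  refine (hfin'.congr_of_eventuallyEq ?_).contMDiffWithinAt
  filter_upwards [hu.mem_nhds hx, e.open_baseSet.mem_nhds hxe] with y hyu hye
  rw [← hHeq y hyu hye, ContinuousLinearMap.inverse_equiv, hα.coeff_apply_of_mem hyu]
  have : (e ⟨y, σ y⟩).2 = e.linearEquivAt ℝ y hye (σ y) := rfl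
  rw [this]
  change _ = ((hα.toBasisAt hyu).equivFun.symm.trans (e.linearEquivAt ℝ y hye)).symm
    (e.linearEquivAt ℝ y hye (σ y)) i
  rw [LinearEquiv.trans_symm, LinearEquiv.trans_apply, LinearEquiv.symm_apply_apply,
    LinearEquiv.symm_symm, Module.Basis.equivFun_apply]

/-- A function which is constant along a line near a point has vanishing derivative along it. -/
theorem fderiv_eq_zero_of_eventually_const {E : Type*} [NormedAddCommGroup E] [NormedSpace ℝ E]
    {f : E → ℝ} {z v : E} (hf : DifferentiableAt ℝ f z)
    (h : ∀ᶠ t in 𝓝 (0 : ℝ), f (z + t • v) = f z) : fderiv ℝ f z v = 0 := by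
  have h1 : HasDerivAt (fun t : ℝ => f (z + t • v)) (fderiv ℝ f z v) 0 := by
    have hl : HasDerivAt (fun t : ℝ => z + t • v) v 0 := by
      simpa using ((hasDerivAt_id (0 : ℝ)).smul_const v).const_add z
    exact hf.hasFDerivAt.comp_hasDerivAt_of_eq 0 hl (by simp)
  exact h1.unique ((hasDerivAt_const (0 : ℝ) (f z)).congr_of_eventuallyEq h)

theorem lieBracket_add_right_of_eventuallyEq {E : Type*} [NormedAddCommGroup E] [NormedSpace ℝ E]
    {V W : E → E} {z v : E} (hV : (fun y => V (y + v)) =ᶠ[𝓝 z] V)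
    (hW : (fun y => W (y + v)) =ᶠ[𝓝 z] W) :
    lieBracket ℝ V W (z + v) = lieBracket ℝ V W z := by
  rw [← hV.lieBracket_vectorField_eq hW]
  simp [lieBracket, fderiv_comp_add_right]

variable {m : ℕ} {M : Type*} [TopologicalSpace M]
  [ChartedSpace (EuclideanSpace ℝ (Fin m)) M] [IsManifold (𝓡 m) ∞ M]
  {F : Type*} [NormedAddCommGroup F] [NormedSpace ℝ F]
  {A : M → Type*} [TopologicalSpace (TotalSpace F A)] [∀ x, TopologicalSpace (A x)]
  [FiberBundle F A] [∀ x, AddCommGroup (A x)] [∀ x, Module ℝ (A x)] [VectorBundle ℝ F A]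

theorem LieAlgebroid.contMDiff_anchorField (L : LieAlgebroid m M F A) (σ : Cₛ^∞⟮𝓡 m; F, A⟯) :
    ContMDiff (𝓡 m) (𝓡 m).tangent ∞
      (fun p => (L.anchor p (σ p) : TangentBundle (𝓡 m) M)) :=
  L.contMDiff_anchor.comp σ.contMDiff

/-- In a splitting frame, the structure functions of the bracket have the required properties. -/
theorem LieAlgebroid.exists_structure_functions [FiniteDimensional ℝ F]
    [ContMDiffVectorBundle ∞ F A (𝓡 m)] (L : LieAlgebroid m M F A) {r q : ℕ}
    (hqm : q ≤ m) (hqr : q ≤ r) {φ : OpenPartialHomeomorph M (EuclideanSpace ℝ (Fin m))}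
    (hφ : IsSmoothChart (m := m) φ) {α : Fin r → Cₛ^∞⟮𝓡 m; F, A⟯} {b : Fin r → Fin m → M → ℝ}
    (hα : IsLocalFrameOn (𝓡 m) F ∞ (fun s x => α s x) φ.source)
    (h1 : ∀ i : Fin q, ∀ p ∈ φ.source,
      L.anchor p (α (Fin.castLE hqr i) p) = coordVec φ (Fin.castLE hqm i) p)
    (h2 : ∀ s : Fin r, q ≤ (s : ℕ) → ∀ p ∈ φ.source,
      L.anchor p (α s p) = ∑ j ∈ {j : Fin m | q ≤ j.val}, b s j p • coordVec φ j p)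
    (hby : ∀ (s : Fin r) (j : Fin m), q ≤ (s : ℕ) → q ≤ (j : ℕ) →
      ∀ p ∈ φ.source, ∀ p' ∈ φ.source,
          (∀ k : Fin m, q ≤ (k : ℕ) → φ p k = φ p' k) → b s j p = b s j p') :
    ∃ c : Fin r → Fin r → Fin r → M → ℝ,
      (∀ s t u : Fin r, ContMDiffOn (𝓡 m) 𝓘(ℝ, ℝ) ∞ (c s t u) φ.source) ∧
      (∀ s t : Fin r, ∀ p ∈ φ.source,
        L.bracket (α s) (α t) p = ∑ u : Fin r, c s t u p • α u p) ∧
      (∀ s t u : Fin r, (u : ℕ) < q → ∀ p ∈ φ.source, c s t u p = 0) ∧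
      (∀ s t : Fin r, ∀ i : Fin q, ∀ j : Fin m, q ≤ (j : ℕ) → ∀ p ∈ φ.source,
        ∑ u ∈ {u : Fin r | q ≤ u.val},
          coordDeriv φ (Fin.castLE hqm i) (c s t u) p * b u j p = 0) := by
  let Y : Fin r → EuclideanSpace ℝ (Fin m) → EuclideanSpace ℝ (Fin m) := fun s =>
    fieldRep φ (fun p => L.anchor p (α s p))
  have hYs : ∀ s, ContDiffOn ℝ ∞ (Y s) φ.target := fun s =>
    hφ.contDiffOn_fieldRep (L.contMDiff_anchorField (α s))
  have hY1 : ∀ s : Fin r, (s : ℕ) < q → ∀ z ∈ φ.target, ∀ j : Fin m,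
      Y s z j = if (s : ℕ) = j then 1 else 0 := by
    intro s hs z hz j
    have h3 : Y s z = EuclideanSpace.single (Fin.castLE hqm ⟨s, hs⟩) (1 : ℝ) := by
      have := h1 ⟨s, hs⟩ (φ.symm z) (φ.map_target hz)
      exact (congrArg (mfderiv (𝓡 m) (𝓡 m) φ (φ.symm z)) this).trans
        (mfderiv_coordVec hφ (φ.map_target hz) _)
    rw [h3, PiLp.single_apply]
    simp [Fin.ext_iff, eq_comm]
  have hY2 : ∀ s : Fin r, q ≤ (s : ℕ) → ∀ z ∈ φ.target, ∀ j : Fin m,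
      Y s z j = if q ≤ (j : ℕ) then b s j (φ.symm z) else 0 := by
    intro s hs z hz j
    have h3 : Y s z = ∑ j ∈ {j : Fin m | q ≤ j.val},
        b s j (φ.symm z) • EuclideanSpace.single j (1 : ℝ) := by
      have h4 := h2 s hs (φ.symm z) (φ.map_target hz)
      have h5 : Y s z = mfderiv (𝓡 m) (𝓡 m) φ (φ.symm z)
          (∑ j ∈ {j : Fin m | q ≤ j.val}, b s j (φ.symm z) • coordVec φ j (φ.symm z)) :=
        congrArg (mfderiv (𝓡 m) (𝓡 m) φ (φ.symm z)) h4
      rw [h5]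
      refine (map_sum _ _ _).trans (Finset.sum_congr rfl fun j _ => ?_)
      exact (map_smul _ _ _).trans (congrArg _ (mfderiv_coordVec hφ (φ.map_target hz) j))
    rw [h3]
    simp [Pi.single_apply]
  have hYinv : ∀ s, ∀ z ∈ φ.target, ∀ z' ∈ φ.target, (∀ k : Fin m, q ≤ (k : ℕ) → z k = z' k) →
      Y s z = Y s z' := by
    intro s z hz z' hz' h
    ext j
    by_cases hs : (s : ℕ) < q
    · rw [hY1 s hs z hz, hY1 s hs z' hz']
    · rw [not_lt] at hs
      rw [hY2 s hs z hz, hY2 s hs z' hz']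
      split_ifs with hj
      · refine hby s j hs hj _ (φ.map_target hz) _ (φ.map_target hz') fun k hk => ?_
        rw [φ.right_inv hz, φ.right_inv hz', h k hk]
      · rfl
  have hYlow : ∀ s, ∀ z ∈ φ.target, ∀ k : Fin m, (k : ℕ) < q →
      Y s z k = if (s : ℕ) = k then 1 else 0 := by
    intro s z hz k hk
    by_cases hs : (s : ℕ) < q
    · exact hY1 s hs z hz k
    · rw [not_lt] at hs
      rw [hY2 s hs z hz, if_neg (by omega), if_neg (by omega)]
  let c : Fin r → Fin r → Fin r → M → ℝ := fun s t u p => hα.coeff u p (L.bracket (α s) (α t) p)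
  have hc : ∀ s t u, ContMDiffOn (𝓡 m) 𝓘(ℝ, ℝ) ∞ (c s t u) φ.source := fun s t u =>
    hα.contMDiffOn_coeff_section φ.open_source _ u
  have hcsum : ∀ s t : Fin r, ∀ p ∈ φ.source,
      L.bracket (α s) (α t) p = ∑ u : Fin r, c s t u p • α u p := fun s t p hp =>
    hα.coeff_sum_eq _ hp
  have hbr : ∀ s t, ∀ z ∈ φ.target,
      lieBracket ℝ (Y s) (Y t) z = ∑ u, c s t u (φ.symm z) • Y u z := by
    intro s t z hz
    rw [hφ.lieBracket_fieldRep (L.contMDiff_anchorField (α s)) (L.contMDiff_anchorField (α t)) hz]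
    have h3 := L.anchor_bracket (α s) (α t) (φ.symm z)
    have h4 := congrArg (L.anchor (φ.symm z)) (hcsum s t _ (φ.map_target hz))
    rw [h3] at h4
    have h5 := congrArg (mfderiv (𝓡 m) (𝓡 m) φ (φ.symm z)) h4
    refine h5.trans ?_
    rw [map_sum]
    refine (map_sum _ _ _).trans (Finset.sum_congr rfl fun u _ => ?_)
    rw [map_smul]
    exact map_smul _ _ _
  have hbrlow : ∀ s t, ∀ z ∈ φ.target, ∀ k : Fin m, (k : ℕ) < q →
      lieBracket ℝ (Y s) (Y t) z k = 0 := by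
    intro s t z hz k hk
    have h3 : ∀ s v, (fderiv ℝ (Y s) z v) k = 0 := by
      intro s v
      have hd : DifferentiableAt ℝ (Y s) z :=
        ((hYs s).contDiffAt (φ.open_target.mem_nhds hz)).differentiableAt (by simp)
      have h4 : HasFDerivAt (fun y => Y s y k) _ z :=
        (EuclideanSpace.proj (𝕜 := ℝ) k).hasFDerivAt.comp z hd.hasFDerivAt
      have h5 : HasFDerivAt (fun y => Y s y k) (0 : EuclideanSpace ℝ (Fin m) →L[ℝ] ℝ) z := by
        refine (hasFDerivAt_const (if (s : ℕ) = k then (1 : ℝ) else 0) z).congr_of_eventuallyEq ?_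
        filter_upwards [φ.open_target.mem_nhds hz] with y hy
        exact hYlow s y hy k hk
      exact congrArg (fun T : EuclideanSpace ℝ (Fin m) →L[ℝ] ℝ => T v) (h4.unique h5)
    simp [lieBracket, h3]
  have hbrj : ∀ s t, ∀ z ∈ φ.target, ∀ j : Fin m, lieBracket ℝ (Y s) (Y t) z j =
      ∑ u, c s t u (φ.symm z) * Y u z j := by
    intro s t z hz j
    rw [hbr s t z hz]
    simp
  have hc0 : ∀ s t u : Fin r, (u : ℕ) < q → ∀ p ∈ φ.source, c s t u p = 0 := by
    intro s t u hu p hp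
    have hz := φ.map_source hp
    -- For an index below q, the component of `Y u'` is the Kronecker delta, so this component of
    -- the bracket isolates a single structure function.
    have h3 := hbrj s t _ hz ⟨u, by omega⟩
    rw [hbrlow s t _ hz _ hu] at h3
    simp only [hYlow _ _ hz ⟨u, by omega⟩ hu, φ.left_inv hp, mul_ite, mul_one, mul_zero,
      ← Fin.ext_iff] at h3
    simpa using h3.symm
  refine ⟨c, hc, hcsum, hc0, ?_⟩
  intro s t i j hj p hp
  set z := φ p with hzdef
  have hz : z ∈ φ.target := φ.map_source hp
  let v : EuclideanSpace ℝ (Fin m) := EuclideanSpace.single (Fin.castLE hqm i) (1 : ℝ)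
  have hv : ∀ k : Fin m, q ≤ (k : ℕ) → v k = 0 := by
    intro k hk
    have : k ≠ Fin.castLE hqm i := by
      intro h
      have := i.2
      rw [h] at hk
      simp at hk
      omega
    simp [v, this]
  have htv : Tendsto (fun t : ℝ => z + t • v) (𝓝 0) (𝓝 z) := by
    have : Continuous (fun t : ℝ => z + t • v) := by fun_prop
    simpa using this.tendsto 0
  have hmem : ∀ᶠ t in 𝓝 (0 : ℝ), z + t • v ∈ φ.target :=
    htv.eventually (φ.open_target.mem_nhds hz)
  have hYt : ∀ u, ∀ᶠ t in 𝓝 (0 : ℝ), Y u (z + t • v) = Y u z := fun u => by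
    filter_upwards [hmem] with t ht
    exact hYinv u _ ht _ hz fun k hk => by simp [hv k hk]
  have hbrt : ∀ᶠ τ in 𝓝 (0 : ℝ),
      lieBracket ℝ (Y s) (Y t) (z + τ • v) = lieBracket ℝ (Y s) (Y t) z := by
    filter_upwards [hmem] with τ hτ
    have key : ∀ u, (fun y => Y u (y + τ • v)) =ᶠ[𝓝 z] Y u := by
      intro u
      have hcont : ContinuousAt (fun y => y + τ • v) z := by fun_prop
      filter_upwards [φ.open_target.mem_nhds hz,
        hcont.preimage_mem_nhds (φ.open_target.mem_nhds hτ)] with y hy hy'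
      exact hYinv u _ hy' _ hy fun k hk => by simp [hv k hk]
    exact lieBracket_add_right_of_eventuallyEq (key s) (key t)
  have hdc : ∀ u, DifferentiableAt ℝ (c s t u ∘ φ.symm) z := by
    intro u
    have h3 : ContMDiffAt (𝓡 m) 𝓘(ℝ, ℝ) ∞ (c s t u) (φ.symm z) :=
      (hc s t u).contMDiffAt (φ.open_source.mem_nhds (φ.map_target hz))
    exact (h3.comp z (hφ.contMDiffAt_symm hz)).contDiffAt.differentiableAt (by simp)
  have hdY : ∀ u, DifferentiableAt ℝ (fun y => Y u y j) z := by
    intro u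
    have hd : DifferentiableAt ℝ (Y u) z :=
      ((hYs u).contDiffAt (φ.open_target.mem_nhds hz)).differentiableAt (by simp)
    exact (EuclideanSpace.proj (𝕜 := ℝ) j).differentiableAt.comp z hd
  -- This sum is the j-th component of the bracket, which does not change along the x-direction `v`.
  have hsum : fderiv ℝ (fun y => ∑ u, (c s t u ∘ φ.symm) y * Y u y j) z v = 0 := by
    refine fderiv_eq_zero_of_eventually_const
      (DifferentiableAt.fun_sum fun u _ => (hdc u).mul (hdY u)) ?_
    filter_upwards [hbrt, hmem] with τ h3 h4
    have h5 := congrArg (fun w : EuclideanSpace ℝ (Fin m) => w j) h3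
    simp only [hbrj s t _ h4, hbrj s t _ hz] at h5
    exact h5
  rw [fderiv_fun_sum (A := fun u y => (c s t u ∘ φ.symm) y * Y u y j)
    fun u _ => (hdc u).mul (hdY u)] at hsum
  have hterm : ∀ u, fderiv ℝ (fun y => (c s t u ∘ φ.symm) y * Y u y j) z v =
      coordDeriv φ (Fin.castLE hqm i) (c s t u) p * Y u z j := by
    intro u
    -- The second term of the product rule vanishes, because the fields themselves depend on y only.
    have h0 : fderiv ℝ (fun y => Y u y j) z v = 0 := by
      refine fderiv_eq_zero_of_eventually_const (hdY u) ?_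
      filter_upwards [hYt u] with τ h3
      rw [h3]
    have h6 := congrArg (fun T : EuclideanSpace ℝ (Fin m) →L[ℝ] ℝ => T v)
      (fderiv_fun_mul (hdc u) (hdY u))
    refine h6.trans ?_
    simp only [add_apply, smul_apply, h0, smul_eq_mul,
      mul_zero, zero_add]
    rw [mul_comm]
    rfl
  rw [sum_apply] at hsum
  simp only [hterm] at hsum
  rw [Finset.sum_filter]
  refine Eq.trans (Finset.sum_congr rfl fun u _ => ?_) hsum
  split_ifs with hu
  · rw [hY2 u hu z hz, if_pos hj, hzdef, φ.left_inv hp]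
  · rw [hY1 u (by omega) z hz, if_neg (by omega), mul_zero]

end StructureFunctions

/-! ### Linear algebra of rank-q maps and the splitting of coordinates. -/

section LinearNormalForm

/-- A linear map of rank `q` is the projection to the first `q` coordinates in suitable bases. -/
theorem LinearMap.exists_rank_normal_form {F G : Type*} [NormedAddCommGroup F] [NormedSpace ℝ F]
    [FiniteDimensional ℝ F] [NormedAddCommGroup G] [NormedSpace ℝ G] [FiniteDimensional ℝ G]
    (T : F →ₗ[ℝ] G) {r m q : ℕ} (hr : Module.finrank ℝ F = r) (hm : Module.finrank ℝ G = m)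
    (hq : Module.finrank ℝ (LinearMap.range T) = q) :
    q ≤ m ∧ q ≤ r ∧
      ∃ (μ : F ≃L[ℝ] (Fin q → ℝ) × ({s : Fin r // q ≤ (s : ℕ)} → ℝ))
        (κ : G ≃L[ℝ] (Fin q → ℝ) × ({j : Fin m // q ≤ (j : ℕ)} → ℝ)),
        ∀ v, κ (T v) = ((μ v).1, 0) := by
  have hqm : q ≤ m := by rw [← hq, ← hm]; exact Submodule.finrank_le _
  have hrk := T.finrank_range_add_finrank_ker
  rw [hq, hr] at hrk
  have hqr : q ≤ r := by omega
  refine ⟨hqm, hqr, ?_⟩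
  have hcard : ∀ n : ℕ, Fintype.card {s : Fin n // q ≤ (s : ℕ)} = n - q := by
    intro n
    rw [Fintype.card_subtype]
    have := Fin.card_filter_val_lt (n := n) (m := q)
    have h2 := Finset.card_filter_add_card_filter_not (s := (Finset.univ : Finset (Fin n)))
      (fun s : Fin n => (s : ℕ) < q)
    simp only [not_lt, Finset.card_univ, Fintype.card_fin] at h2
    omega
  obtain ⟨C, hC⟩ := Submodule.exists_isCompl (LinearMap.ker T)
  obtain ⟨D, hD⟩ := Submodule.exists_isCompl (LinearMap.range T)
  have hDfin := Submodule.finrank_add_eq_of_isCompl hD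
  rw [hq, hm] at hDfin
  let ε := T.kerComplementEquivRange hC.symm
  -- The same `ε1` serves for the range and, through `ε`, for the complement of the kernel; this
  -- makes the nonzero block exactly the identity.
  let ε1 : LinearMap.range T ≃ₗ[ℝ] (Fin q → ℝ) := LinearEquiv.ofFinrankEq _ _ (by simp [hq])
  let k1 : LinearMap.ker T ≃ₗ[ℝ] ({s : Fin r // q ≤ (s : ℕ)} → ℝ) :=
    LinearEquiv.ofFinrankEq _ _ (by rw [Module.finrank_fintype_fun_eq_card, hcard]; omega)
  let d1 : D ≃ₗ[ℝ] ({j : Fin m // q ≤ (j : ℕ)} → ℝ) :=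
    LinearEquiv.ofFinrankEq _ _ (by rw [Module.finrank_fintype_fun_eq_card, hcard]; omega)
  let e1 := Submodule.prodEquivOfIsCompl C (LinearMap.ker T) hC.symm
  let e2 := Submodule.prodEquivOfIsCompl (LinearMap.range T) D hD
  refine ⟨(e1.symm.trans ((ε.trans ε1).prodCongr k1)).toContinuousLinearEquiv,
    (e2.symm.trans (ε1.prodCongr d1)).toContinuousLinearEquiv, fun v => ?_⟩
  obtain ⟨⟨a, k⟩, rfl⟩ := e1.surjective v
  have h1 : T (e1 (a, k)) = e2 (ε a, 0) := by
    have hk : T (k : F) = 0 := k.2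
    have h2 : ((ε a : LinearMap.range T) : G) = T a := rfl
    simp [e1, e2, hk, h2]
  change (ε1.prodCongr d1) (e2.symm (T (e1 (a, k)))) =
    (((ε.trans ε1).prodCongr k1 (e1.symm (e1 (a, k)))).1, 0)
  rw [h1, e2.symm_apply_apply, e1.symm_apply_apply]
  simp

/-- Splitting off the first `q` coordinates of a vector. -/
noncomputable def splitEquiv {q n : ℕ} (h : q ≤ n) :
    EuclideanSpace ℝ (Fin n) ≃L[ℝ] (Fin q → ℝ) × ({j : Fin n // q ≤ (j : ℕ)} → ℝ) :=
  LinearEquiv.toContinuousLinearEquiv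
    { toFun := fun x => (fun i => x (Fin.castLE h i), fun j => x j.1)
      map_add' := fun _ _ => rfl
      map_smul' := fun _ _ => rfl
      invFun := fun y => WithLp.toLp 2 fun j =>
        if hj : q ≤ (j : ℕ) then y.2 ⟨j, hj⟩ else y.1 ⟨j, not_le.1 hj⟩
      left_inv := fun x => by
        ext j
        by_cases hj : q ≤ (j : ℕ) <;> simp [hj]
      right_inv := fun y => by
        refine Prod.ext (funext fun i => ?_) (funext fun j => ?_)
        · simp
        · simp [j.2] }

variable {q n : ℕ} (h : q ≤ n)

theorem splitEquiv_apply_fst (x : EuclideanSpace ℝ (Fin n)) (i : Fin q) :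
    (splitEquiv h x).1 i = x (Fin.castLE h i) := rfl

theorem splitEquiv_apply_snd (x : EuclideanSpace ℝ (Fin n)) (j : {j : Fin n // q ≤ (j : ℕ)}) :
    (splitEquiv h x).2 j = x j := rfl

theorem splitEquiv_single_castLE (i : Fin q) :
    splitEquiv h (EuclideanSpace.single (Fin.castLE h i) (1 : ℝ)) = (Pi.single i 1, 0) := by
  refine Prod.ext (funext fun k => ?_) (funext fun j => ?_)
  · rw [splitEquiv_apply_fst]
    simp [Pi.single_apply, Fin.ext_iff]
  · rw [splitEquiv_apply_snd]
    have : (j : Fin n) ≠ Fin.castLE h i := by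
      intro h'
      have h1 := j.2
      rw [h'] at h1
      simp at h1
      omega
    simp [this]

theorem splitEquiv_single_of_le {s : Fin n} (hs : q ≤ (s : ℕ)) :
    splitEquiv h (EuclideanSpace.single s (1 : ℝ)) = (0, Pi.single ⟨s, hs⟩ 1) := by
  refine Prod.ext (funext fun k => ?_) (funext fun j => ?_)
  · rw [splitEquiv_apply_fst]
    have : Fin.castLE h k ≠ s := by
      intro h'
      rw [← h'] at hs
      simp at hs
      omega
    simp [this]
  · rw [splitEquiv_apply_snd]
    simp [Pi.single_apply, Subtype.ext_iff]

end LinearNormalForm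

/-! ### Extending local sections to global ones. -/

section SectionExtension

open Set Filter Topology

variable {m : ℕ} {M : Type*} [TopologicalSpace M]
  [ChartedSpace (EuclideanSpace ℝ (Fin m)) M] [IsManifold (𝓡 m) ∞ M]
  {F : Type*} [NormedAddCommGroup F] [NormedSpace ℝ F]
  {A : M → Type*} [TopologicalSpace (TotalSpace F A)] [∀ x, TopologicalSpace (A x)]
  [FiberBundle F A] [∀ x, AddCommGroup (A x)] [∀ x, Module ℝ (A x)] [VectorBundle ℝ F A]

/-- A local smooth section agrees near a given point with a global one. -/
theorem exists_contMDiffSection_eventuallyEq [T2Space M] {u : Set M} (hu : IsOpen u) {x₀ : M}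
    (hx₀ : x₀ ∈ u) {τ : ∀ x, A x}
    (hτ : ContMDiffOn (𝓡 m) ((𝓡 m).prod 𝓘(ℝ, F)) ∞ (fun x => TotalSpace.mk' F x (τ x)) u) :
    ∃ σ : Cₛ^∞⟮𝓡 m; F, A⟯, ∀ᶠ x in 𝓝 x₀, σ x = τ x := by
  obtain ⟨f, -, hf⟩ := (SmoothBumpFunction.nhds_basis_tsupport (I := 𝓡 m) x₀).mem_iff.1
    (hu.mem_nhds hx₀)
  refine ⟨⟨fun x => f x • τ x, ContMDiffOn.smul_section_of_tsupport f.contMDiff.contMDiffOn hu hf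
    hτ⟩, ?_⟩
  filter_upwards [f.eventuallyEq_one] with x hx
  change f x • τ x = τ x
  rw [hx]
  exact one_smul ℝ (τ x)

/-- The sections which are constant near a point in a trivialization extend, linearly in the
constant. -/
theorem exists_linear_family_section [T2Space M] [ContMDiffVectorBundle ∞ F A (𝓡 m)]
    {V : Type*} [NormedAddCommGroup V] [NormedSpace ℝ V] [FiniteDimensional ℝ V]
    (ν : V →L[ℝ] F) (x₀ : M) :
    ∃ σ : V →ₗ[ℝ] Cₛ^∞⟮𝓡 m; F, A⟯, ∀ᶠ p in 𝓝 x₀, ∀ v,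
      σ v p = (trivializationAt F A x₀).symm p (ν v) := by
  set e := trivializationAt F A x₀ with he
  have hx : x₀ ∈ e.baseSet := FiberBundle.mem_baseSet_trivializationAt F A x₀
  have hloc : ∀ a : F, ∃ σ : Cₛ^∞⟮𝓡 m; F, A⟯, ∀ᶠ x in 𝓝 x₀, σ x = e.symm x a := by
    intro a
    refine exists_contMDiffSection_eventuallyEq e.open_baseSet hx ?_
    rw [e.contMDiffOn_section_baseSet_iff]
    refine contMDiffOn_const (c := a) |>.congr fun y hy => ?_
    rw [e.apply_mk_symm hy]
  -- Extending only the images of a basis makes the family linear and needs just finitely many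
  -- neighbourhoods.
  let B := Module.finBasis ℝ V
  choose σ hσ using fun i => hloc (ν (B i))
  refine ⟨B.constr ℝ σ, ?_⟩
  filter_upwards [eventually_all.2 hσ, e.open_baseSet.mem_nhds hx] with p hp hpe v
  have h1 : e.symm p (ν v) = (e.linearEquivAt ℝ p hpe).symm (ν v) := rfl
  have h2 : ∀ i, σ i p = (e.linearEquivAt ℝ p hpe).symm (ν (B i)) := hp
  have h3 : (B.constr ℝ σ v) p = ∑ i, B.repr v i • σ i p := by
    rw [Module.Basis.constr_apply_fintype]
    exact map_sum (⟨⟨fun τ : Cₛ^∞⟮𝓡 m; F, A⟯ => τ p, rfl⟩, fun _ _ => rfl⟩ :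
      Cₛ^∞⟮𝓡 m; F, A⟯ →+ A p) _ _
  rw [h1, h3]
  conv_rhs => rw [← B.sum_repr v, map_sum, map_sum]
  refine Finset.sum_congr rfl fun i _ => ?_
  rw [h2, map_smul, map_smul]

end SectionExtension

/-! ### The anchor as an involutive family on a vector space. -/

section LocalModel

open Set Filter Topology

variable {m : ℕ} {M : Type*} [TopologicalSpace M]
  [ChartedSpace (EuclideanSpace ℝ (Fin m)) M] [IsManifold (𝓡 m) ∞ M]
  {F : Type*} [NormedAddCommGroup F] [NormedSpace ℝ F]
  {A : M → Type*} [TopologicalSpace (TotalSpace F A)] [∀ x, TopologicalSpace (A x)]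
  [FiberBundle F A] [∀ x, AddCommGroup (A x)] [∀ x, Module ℝ (A x)] [VectorBundle ℝ F A]

/-- In a chart and a trivialization, the anchor becomes a smooth family of linear maps, which is
involutive. -/
theorem LieAlgebroid.exists_local_model [T2Space M] [ContMDiffVectorBundle ∞ F A (𝓡 m)]
    (L : LieAlgebroid m M F A)
    {E : Type*} [NormedAddCommGroup E] [NormedSpace ℝ E] [FiniteDimensional ℝ E]
    {V : Type*} [NormedAddCommGroup V] [NormedSpace ℝ V] [FiniteDimensional ℝ V]
    (ν : V ≃L[ℝ] F) {χ : OpenPartialHomeomorph M E} (hχ : IsSmoothChart (m := m) χ) {x₀ : M}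
    (hx₀ : x₀ ∈ χ.source) :
    ∃ (X : E → V →L[ℝ] E) (c : E → V →L[ℝ] V →L[ℝ] V), ContDiff ℝ ∞ X ∧ ContDiff ℝ ∞ c ∧
      (∀ᶠ z in 𝓝 (χ x₀), ∀ v w,
        fderiv ℝ X z (X z v) w - fderiv ℝ X z (X z w) v = X z (c z v w)) ∧
      ∀ᶠ p in 𝓝 x₀, ∀ v, mfderiv (𝓡 m) 𝓘(ℝ, E) χ p
        (L.anchor p ((trivializationAt F A x₀).symm p (ν v))) = X (χ p) v := by
  have : CompleteSpace E := FiniteDimensional.complete ℝ E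
  obtain ⟨σ, hσ⟩ := exists_linear_family_section (m := m) (A := A) (ν : V →L[ℝ] F) x₀
  set e := trivializationAt F A x₀ with he
  have hxe : x₀ ∈ e.baseSet := FiberBundle.mem_baseSet_trivializationAt F A x₀
  let Y : V → E → E := fun v => fieldRep χ (fun p => L.anchor p (σ v p))
  have hYadd : ∀ z v w, Y (v + w) z = Y v z + Y w z := by
    intro z v w
    have h1 : L.anchor (χ.symm z) (σ (v + w) (χ.symm z)) =
        L.anchor (χ.symm z) (σ v (χ.symm z)) + L.anchor (χ.symm z) (σ w (χ.symm z)) := by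
      rw [map_add]; exact map_add _ _ _
    exact (congrArg (mfderiv (𝓡 m) 𝓘(ℝ, E) χ (χ.symm z)) h1).trans (map_add _ _ _)
  have hYsmul : ∀ z (a : ℝ) v, Y (a • v) z = a • Y v z := by
    intro z a v
    have h1 : L.anchor (χ.symm z) (σ (a • v) (χ.symm z)) =
        a • L.anchor (χ.symm z) (σ v (χ.symm z)) := by
      rw [map_smul]; exact map_smul _ _ _
    exact (congrArg (mfderiv (𝓡 m) 𝓘(ℝ, E) χ (χ.symm z)) h1).trans (map_smul _ _ _)
  have hYs : ∀ v, ContDiffOn ℝ ∞ (Y v) χ.target := fun v =>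
    hχ.contDiffOn_fieldRep (L.contMDiff_anchorField (σ v))
  let X₀ : E → V →L[ℝ] E := fun z => LinearMap.toContinuousLinearMap
    { toFun := fun v => Y v z, map_add' := hYadd z, map_smul' := hYsmul z }
  have hX₀ : ContDiffOn ℝ ∞ X₀ χ.target := contDiffOn_clm_apply.2 hYs
  -- `linearMapAt` is zero off the base set; only points of `N` below matter.
  let ev : E → Cₛ^∞⟮𝓡 m; F, A⟯ →ₗ[ℝ] V := fun z =>
    { toFun := fun τ => ν.symm (e.linearMapAt ℝ (χ.symm z) (τ (χ.symm z)))
      map_add' := fun τ υ => by rw [← map_add, ← map_add]; rfl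
      map_smul' := fun a τ => by rw [RingHom.id_apply, ← map_smul, ← map_smul]; rfl }
  let c₀ : E → V →L[ℝ] V →L[ℝ] V := fun z =>
    LinearMap.toContinuousBilinearMap ((L.bracket.compl₁₂ σ σ).compr₂ (ev z))
  have hc₀app : ∀ z v w, c₀ z v w = ν.symm (e.linearMapAt ℝ (χ.symm z)
      (L.bracket (σ v) (σ w) (χ.symm z))) := fun _ _ _ => rfl
  let N : Set E := χ.target ∩ χ.symm ⁻¹' e.baseSet
  have hN : IsOpen N := χ.isOpen_inter_preimage_symm e.open_baseSet
  have hx₀N : χ x₀ ∈ N := ⟨χ.map_source hx₀, by simpa [χ.left_inv hx₀] using hxe⟩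
  have hc₀ : ContDiffOn ℝ ∞ c₀ N := by
    refine contDiffOn_clm_apply.2 fun v => contDiffOn_clm_apply.2 fun w => ?_
    have h1 : ContMDiffOn (𝓡 m) 𝓘(ℝ, F) ∞ (fun p => (e ⟨p, L.bracket (σ v) (σ w) p⟩).2)
        e.baseSet := e.contMDiffOn_section_baseSet_iff.1 (L.bracket (σ v) (σ w)).contMDiff.contMDiffOn
    have h2 := (h1.comp (hχ.contMDiffOn_symm.mono inter_subset_left)
      (fun z hz => hz.2 : N ⊆ χ.symm ⁻¹' e.baseSet)).contDiffOn
    refine (ν.symm.contDiff.comp_contDiffOn h2).congr fun z hz => ?_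
    rw [hc₀app, e.coe_linearMapAt_of_mem hz.2]
    rfl
  obtain ⟨X, hX, hXX₀⟩ := exists_contDiff_eventuallyEq χ.open_target hX₀ (χ.map_source hx₀)
  obtain ⟨c, hc, hcc₀⟩ := exists_contDiff_eventuallyEq hN hc₀ hx₀N
  have hσ' : ∀ᶠ z in 𝓝 (χ x₀), ∀ v, σ v (χ.symm z) = e.symm (χ.symm z) (ν v) := by
    have h1 := χ.continuousAt_symm (χ.map_source hx₀)
    unfold ContinuousAt at h1
    rw [χ.left_inv hx₀] at h1
    exact h1.eventually hσ
  refine ⟨X, c, hX, hc, ?_, ?_⟩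
  · filter_upwards [hXX₀.eventuallyEq_nhds, hcc₀, hN.mem_nhds hx₀N, hσ'] with z hz hcz hzN hσz v w
    rw [hz.fderiv_eq, hz.eq_of_nhds, hcz]
    have hd : DifferentiableAt ℝ X₀ z :=
      (hX₀.contDiffAt (χ.open_target.mem_nhds hzN.1)).differentiableAt (by simp)
    have hdY : ∀ v u, fderiv ℝ (Y v) z u = fderiv ℝ X₀ z u v := by
      intro v u
      have h1 : HasFDerivAt (fun y => X₀ y v) _ z := hd.hasFDerivAt.clm_apply (hasFDerivAt_const v z)
      have h2 := congrArg (fun T : E →L[ℝ] E => T u) h1.fderiv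
      refine h2.trans ?_
      simp
    have h1 := hχ.lieBracket_fieldRep (L.contMDiff_anchorField (σ v))
      (L.contMDiff_anchorField (σ w)) hzN.1
    have h2 : lieBracket ℝ (Y v) (Y w) z =
        fderiv ℝ X₀ z (X₀ z v) w - fderiv ℝ X₀ z (X₀ z w) v := by
      rw [← hdY, ← hdY]; rfl
    rw [← h2]
    refine h1.trans ?_
    -- A pointwise equality suffices, since the anchor is applied fibrewise. All brackets are of
    -- global sections, so no locality of the bracket is needed.
    have h3 : L.bracket (σ v) (σ w) (χ.symm z) = σ (c₀ z v w) (χ.symm z) := by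
      rw [hσz, hc₀app]
      simp only [ContinuousLinearEquiv.apply_symm_apply]
      exact (e.symm_linearMapAt (R := ℝ) hzN.2 _).symm
    refine congrArg (mfderiv (𝓡 m) 𝓘(ℝ, E) χ (χ.symm z)) ?_
    exact (L.anchor_bracket (σ v) (σ w) (χ.symm z)).symm.trans (congrArg _ h3)
  · filter_upwards [hσ, χ.open_source.mem_nhds hx₀,
      (χ.continuousAt hx₀).eventually hXX₀] with p hp hps hpX v
    rw [hpX]
    change _ = mfderiv (𝓡 m) 𝓘(ℝ, E) χ (χ.symm (χ p)) (L.anchor _ (σ v (χ.symm (χ p))))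
    rw [χ.left_inv hps, hp v]
    rfl

end LocalModel

/-! ### Composition and restriction of smooth charts. -/

section ChartOperations

open Set Filter Topology

variable {m : ℕ} {M : Type*} [TopologicalSpace M] [ChartedSpace (EuclideanSpace ℝ (Fin m)) M]
  {E E' : Type*} [NormedAddCommGroup E] [NormedSpace ℝ E] [NormedAddCommGroup E']
  [NormedSpace ℝ E'] {χ : OpenPartialHomeomorph M E}

theorem IsSmoothChart.trans (hχ : IsSmoothChart (m := m) χ) {θ : OpenPartialHomeomorph E E'}
    (hθ : ContDiffOn ℝ ∞ θ θ.source) (hθ' : ContDiffOn ℝ ∞ θ.symm θ.target) :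
    IsSmoothChart (m := m) (χ.trans θ) where
  contMDiffOn := by
    refine hθ.contMDiffOn.comp (hχ.contMDiffOn.mono fun p hp => ?_) fun p hp => ?_
    · exact (by simpa using hp : p ∈ χ.source ∧ χ p ∈ θ.source).1
    · exact (by simpa using hp : p ∈ χ.source ∧ χ p ∈ θ.source).2
  contMDiffOn_symm := by
    refine hχ.contMDiffOn_symm.comp (hθ'.contMDiffOn.mono fun z hz => ?_) fun z hz => ?_
    · exact (by simpa [OpenPartialHomeomorph.trans_target] using hz :
        z ∈ θ.target ∧ θ.symm z ∈ χ.target).1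
    · exact (by simpa [OpenPartialHomeomorph.trans_target] using hz :
        z ∈ θ.target ∧ θ.symm z ∈ χ.target).2

theorem IsSmoothChart.restrOpen (hχ : IsSmoothChart (m := m) χ) {s : Set M} (hs : IsOpen s) :
    IsSmoothChart (m := m) (χ.restrOpen s hs) where
  contMDiffOn := hχ.contMDiffOn.mono fun p hp => by
    rw [OpenPartialHomeomorph.restrOpen_source] at hp; exact hp.1
  contMDiffOn_symm := hχ.contMDiffOn_symm.mono fun z hz => by
    have h1 := (χ.restrOpen s hs).map_target hz
    rw [OpenPartialHomeomorph.restrOpen_source] at h1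
    rw [← (χ.restrOpen s hs).right_inv hz]
    exact χ.map_source h1.1

theorem IsSmoothChart.mfderiv_comp_apply (hχ : IsSmoothChart (m := m) χ) {p : M}
    (hp : p ∈ χ.source) {f : E → E'} {f' : E →L[ℝ] E'} (hf : HasFDerivAt f f' (χ p))
    (Y : TangentSpace (𝓡 m) p) :
    mfderiv (𝓡 m) 𝓘(ℝ, E') (fun x => f (χ x)) p Y = f' (mfderiv (𝓡 m) 𝓘(ℝ, E) χ p Y) := by
  have h1 : HasMFDerivAt (𝓡 m) 𝓘(ℝ, E') (f ∘ χ) p _ := hf.hasMFDerivAt.comp p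
    ((hχ.mdifferentiable.mdifferentiableAt hp).hasMFDerivAt)
  exact congrArg (fun T : TangentSpace (𝓡 m) p →L[ℝ] E' => T Y) h1.mfderiv

theorem isSmoothChart_chartAt [IsManifold (𝓡 m) ∞ M] (x : M) :
    IsSmoothChart (m := m) (chartAt (EuclideanSpace ℝ (Fin m)) x) :=
  ⟨contMDiffOn_chart, contMDiffOn_chart_symm⟩

theorem IsSmoothChart.mem_maximalAtlas [IsManifold (𝓡 m) ∞ M]
    {φ : OpenPartialHomeomorph M (EuclideanSpace ℝ (Fin m))} (hφ : IsSmoothChart (m := m) φ) :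
    φ ∈ IsManifold.maximalAtlas (𝓡 m) ∞ M :=
  φ.mem_maximalAtlas_of_contMDiffOn hφ.contMDiffOn hφ.contMDiffOn_symm

end ChartOperations

/-! ### Normal form of the anchor in a chart of the manifold. -/

section NormalForm

open Set Filter Topology

variable {m : ℕ} {M : Type*} [TopologicalSpace M]
  [ChartedSpace (EuclideanSpace ℝ (Fin m)) M] [IsManifold (𝓡 m) ∞ M]
  {F : Type*} [NormedAddCommGroup F] [NormedSpace ℝ F]
  {A : M → Type*} [TopologicalSpace (TotalSpace F A)] [∀ x, TopologicalSpace (A x)]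
  [FiberBundle F A] [∀ x, AddCommGroup (A x)] [∀ x, Module ℝ (A x)] [VectorBundle ℝ F A]

/-- Near any point there are a chart and a trivialization in which the anchor at that point is the
projection to the first `q` coordinates. -/
theorem LieAlgebroid.exists_chart_rank_normal_form [FiniteDimensional ℝ F]
    (L : LieAlgebroid m M F A) {r q : ℕ} (hr : Module.finrank ℝ F = r) (x₀ : M)
    (hq : Module.finrank ℝ (LinearMap.range (L.anchor x₀)) = q) :
    q ≤ m ∧ q ≤ r ∧
      ∃ (μ : F ≃L[ℝ] (Fin q → ℝ) × ({s : Fin r // q ≤ (s : ℕ)} → ℝ))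
        (χ : OpenPartialHomeomorph M ((Fin q → ℝ) × ({j : Fin m // q ≤ (j : ℕ)} → ℝ))),
        IsSmoothChart (m := m) χ ∧ x₀ ∈ χ.source ∧ χ x₀ = 0 ∧
        ∀ v, mfderiv (𝓡 m) 𝓘(ℝ, (Fin q → ℝ) × ({j : Fin m // q ≤ (j : ℕ)} → ℝ)) χ x₀
          (L.anchor x₀ ((trivializationAt F A x₀).symm x₀ (μ.symm v))) = (v.1, 0) := by
  set e := trivializationAt F A x₀ with he
  have hxe : x₀ ∈ e.baseSet := FiberBundle.mem_baseSet_trivializationAt F A x₀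
  let χ₀ := chartAt (EuclideanSpace ℝ (Fin m)) x₀
  have hχ₀ : IsSmoothChart (m := m) χ₀ := isSmoothChart_chartAt x₀
  have hx₀ : x₀ ∈ χ₀.source := mem_chart_source _ x₀
  let D : TangentSpace (𝓡 m) x₀ ≃ₗ[ℝ] EuclideanSpace ℝ (Fin m) :=
    (hχ₀.mdifferentiable.mfderiv hx₀).toLinearEquiv
  let T : F →ₗ[ℝ] EuclideanSpace ℝ (Fin m) :=
    D.toLinearMap ∘ₗ L.anchor x₀ ∘ₗ (e.linearEquivAt ℝ x₀ hxe).symm.toLinearMap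
  have hT : Module.finrank ℝ (LinearMap.range T) = q := by
    rw [LinearMap.range_comp, LinearEquiv.finrank_map_eq, LinearEquiv.range_comp, hq]
  obtain ⟨hqm, hqr, μ, κ, hκ⟩ := T.exists_rank_normal_form hr finrank_euclideanSpace_fin hT
  let θ := ((Homeomorph.subRight (χ₀ x₀)).trans κ.toHomeomorph).toOpenPartialHomeomorph
  have hθ : ∀ z, HasFDerivAt θ (κ : EuclideanSpace ℝ (Fin m) →L[ℝ]
      (Fin q → ℝ) × ({j : Fin m // q ≤ (j : ℕ)} → ℝ)) z := fun z =>
    κ.hasFDerivAt.comp z ((hasFDerivAt_id z).sub_const (χ₀ x₀))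
  refine ⟨hqm, hqr, μ, χ₀.trans θ, hχ₀.trans ?_ ?_, ?_, ?_, fun v => ?_⟩
  · exact (κ.contDiff.comp (contDiff_id.sub contDiff_const)).contDiffOn
  · exact (κ.symm.contDiff.add contDiff_const).contDiffOn
  · simpa [θ] using hx₀
  · change κ (χ₀ x₀ - χ₀ x₀) = 0
    simp
  · refine (hχ₀.mfderiv_comp_apply hx₀ (hθ _) _).trans ?_
    refine (hκ (μ.symm v)).trans ?_
    rw [μ.apply_symm_apply]

/-- Near any point there are a chart and a frame in which the anchor is the sum of the identity in
the first `q` coordinates and of a map which depends on the other coordinates only. -/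
theorem LieAlgebroid.exists_chart_normal_form [T2Space M] [FiniteDimensional ℝ F]
    [ContMDiffVectorBundle ∞ F A (𝓡 m)]
    (L : LieAlgebroid m M F A) {r q : ℕ} (hr : Module.finrank ℝ F = r) (x₀ : M)
    (hq : Module.finrank ℝ (LinearMap.range (L.anchor x₀)) = q) :
    q ≤ m ∧ q ≤ r ∧
      ∃ (χ : OpenPartialHomeomorph M ((Fin q → ℝ) × ({j : Fin m // q ≤ (j : ℕ)} → ℝ)))
        (G : M → (Fin q → ℝ) × ({s : Fin r // q ≤ (s : ℕ)} → ℝ) →L[ℝ] F)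
        (b : ({j : Fin m // q ≤ (j : ℕ)} → ℝ) →
          ({s : Fin r // q ≤ (s : ℕ)} → ℝ) →L[ℝ] ({j : Fin m // q ≤ (j : ℕ)} → ℝ)),
        IsSmoothChart (m := m) χ ∧ x₀ ∈ χ.source ∧ χ x₀ = 0 ∧
        χ.source ⊆ (trivializationAt F A x₀).baseSet ∧
        ContMDiffOn (𝓡 m)
          𝓘(ℝ, (Fin q → ℝ) × ({s : Fin r // q ≤ (s : ℕ)} → ℝ) →L[ℝ] F) ∞ G χ.source ∧
        ContDiff ℝ ∞ b ∧ b 0 = 0 ∧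
        ∀ p ∈ χ.source, Function.Bijective (G p) ∧
          ∀ v, mfderiv (𝓡 m) 𝓘(ℝ, (Fin q → ℝ) × ({j : Fin m // q ≤ (j : ℕ)} → ℝ)) χ p
            (L.anchor p ((trivializationAt F A x₀).symm p (G p v))) = (v.1, b (χ p).2 v.2) := by
  obtain ⟨hqm, hqr, μ, χ, hχ, hx₀, hχ0, hrank⟩ := L.exists_chart_rank_normal_form hr x₀ hq
  refine ⟨hqm, hqr, ?_⟩
  obtain ⟨X, c, hX, hc, hinv, hXχ⟩ := L.exists_local_model μ.symm hχ hx₀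
  rw [hχ0] at hinv
  have hX0 : ∀ v, X 0 v = (v.1, 0) := by
    intro v
    rw [← hχ0, ← hXχ.self_of_nhds v]
    exact hrank v
  obtain ⟨ψ, g, b, N, hN, h0N, hψ, hg, hb, hψ0, hψ', hg0, hb0, hXψ⟩ :=
    exists_analytic_splitting hX hc hinv hX0
  -- Shrinking to where `g` is invertible ensures that `G p` is bijective, hence that it yields a
  -- frame.
  let N₁ : Set ((Fin q → ℝ) × ({j : Fin m // q ≤ (j : ℕ)} → ℝ)) :=
    N ∩ g ⁻¹' range ((↑) : (((Fin q → ℝ) × ({s : Fin r // q ≤ (s : ℕ)} → ℝ)) ≃L[ℝ]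
      ((Fin q → ℝ) × ({s : Fin r // q ≤ (s : ℕ)} → ℝ))) → _)
  have hN₁ : IsOpen N₁ := hg.continuousOn.isOpen_inter_preimage hN ContinuousLinearEquiv.isOpen
  have h0N₁ : 0 ∈ N₁ := ⟨h0N, ContinuousLinearEquiv.refl ℝ _, hg0.symm⟩
  obtain ⟨θ, h0θ, hθN, hθψ, hθs, hθd⟩ := exists_openPartialHomeomorph_contDiffOn hN₁
    (hψ.mono inter_subset_left) h0N₁ (ContinuousLinearEquiv.refl ℝ _) hψ'
  have hθ : IsSmoothChart (m := m) (χ.trans θ.symm) :=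
    hχ.trans hθs (by
      rw [θ.symm_symm, hθψ, θ.symm_target]
      exact hψ.mono (hθN.trans inter_subset_left))
  have hθ0 : θ.symm 0 = 0 := by
    have := θ.left_inv h0θ
    rwa [hθψ, hψ0] at this
  have h0θt : (0 : (Fin q → ℝ) × ({j : Fin m // q ≤ (j : ℕ)} → ℝ)) ∈ θ.target := by
    have := θ.map_source h0θ
    rwa [hθψ, hψ0] at this
  obtain ⟨O, hOsub, hO, hx₀O⟩ := eventually_nhds_iff.1
    (hXχ.and ((trivializationAt F A x₀).open_baseSet.mem_nhds
      (FiberBundle.mem_baseSet_trivializationAt F A x₀)))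
  have hsrc : ∀ p ∈ ((χ.trans θ.symm).restrOpen O hO).source,
      p ∈ (χ.trans θ.symm).source ∧ p ∈ χ.source ∧ θ.symm (χ p) ∈ θ.source ∧
        ψ (θ.symm (χ p)) = χ p ∧ p ∈ O := by
    intro p hp
    rw [OpenPartialHomeomorph.restrOpen_source] at hp
    have h1 : p ∈ χ.source ∧ χ p ∈ θ.target := by simpa using hp.1
    refine ⟨hp.1, h1.1, θ.map_target h1.2, ?_, hp.2⟩
    rw [← hθψ, θ.right_inv h1.2]
  refine ⟨(χ.trans θ.symm).restrOpen O hO,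
    fun p => (μ.symm : _ →L[ℝ] F).comp (g (θ.symm (χ p))), b, hθ.restrOpen hO, ?_, ?_, ?_, ?_,
    hb, hb0, ?_⟩
  · rw [OpenPartialHomeomorph.restrOpen_source]
    refine ⟨?_, hx₀O⟩
    simp [hx₀, hχ0, h0θt]
  · change θ.symm (χ x₀) = 0
    rw [hχ0, hθ0]
  · exact fun p hp => (hOsub p (hsrc p hp).2.2.2.2).2
  · have h1 : ContMDiffOn (𝓡 m) _ ∞ (fun p => g (θ.symm (χ p)))
        ((χ.trans θ.symm).restrOpen O hO).source :=
      hg.contMDiffOn.comp (hθ.restrOpen hO).contMDiffOn fun p hp =>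
        (hθN (hsrc p hp).2.2.1).1
    exact ((ContinuousLinearMap.compL ℝ _ _ F)
      (μ.symm : _ →L[ℝ] F)).contDiff.contMDiff.comp_contMDiffOn h1
  · intro p hp
    obtain ⟨hpt, hpχ, hpθ, hψp, hpO⟩ := hsrc p hp
    refine ⟨?_, fun v => ?_⟩
    · obtain ⟨g', hg'⟩ := (hθN hpθ).2
      refine μ.symm.bijective.comp ?_
      rw [← hg']
      exact g'.bijective
    · obtain ⟨ψ', hψ'p⟩ := hθd _ hpθ
      -- Both sides are compared after applying the invertible differential of ψ: since ψ composed
      -- with the new chart is χ near `p`, the left side becomes the anchor read in χ.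
      apply ψ'.injective
      have h1 := (hθ.mfderiv_comp_apply hpt hψ'p
        (L.anchor p ((trivializationAt F A x₀).symm p (μ.symm (g (θ.symm (χ p)) v)))))
      have h2 : (fun x => ψ ((χ.trans θ.symm) x)) =ᶠ[𝓝 p] χ := by
        filter_upwards [((χ.trans θ.symm).restrOpen O hO).open_source.mem_nhds hp] with x hx
        exact (hsrc x hx).2.2.2.1
      rw [h2.mfderiv_eq] at h1
      have h3 := (hOsub p hpO).1 (g (θ.symm (χ p)) v)
      have h4 := hXψ _ (hθN hpθ).1 v
      rw [hψp, hψ'p.fderiv] at h4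
      exact h1.symm.trans (h3.trans h4)

end NormalForm

/-! ### Return to indexed coordinates and global sections. -/

section Splitting

open Set Filter Topology

variable {m : ℕ} {M : Type*} [TopologicalSpace M]
  [ChartedSpace (EuclideanSpace ℝ (Fin m)) M] [IsManifold (𝓡 m) ∞ M]
  {F : Type*} [NormedAddCommGroup F] [NormedSpace ℝ F]
  {A : M → Type*} [TopologicalSpace (TotalSpace F A)] [∀ x, TopologicalSpace (A x)]
  [FiberBundle F A] [∀ x, AddCommGroup (A x)] [∀ x, Module ℝ (A x)] [VectorBundle ℝ F A]

/-- The splitting of the anchor near a point where it has rank `q`. -/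
theorem LieAlgebroid.exists_anchor_splitting [T2Space M] [FiniteDimensional ℝ F]
    [ContMDiffVectorBundle ∞ F A (𝓡 m)]
    (L : LieAlgebroid m M F A) {r q : ℕ} (hr : Module.finrank ℝ F = r) (x₀ : M)
    (hq : Module.finrank ℝ (LinearMap.range (L.anchor x₀)) = q) :
    ∃ (hqm : q ≤ m) (hqr : q ≤ r)
      (φ : OpenPartialHomeomorph M (EuclideanSpace ℝ (Fin m)))
      (α : Fin r → Cₛ^∞⟮𝓡 m; F, A⟯) (b : Fin r → Fin m → M → ℝ),
      IsSmoothChart (m := m) φ ∧ x₀ ∈ φ.source ∧ φ x₀ = 0 ∧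
      IsLocalFrameOn (𝓡 m) F ∞ (fun s x => α s x) φ.source ∧
      (∀ i : Fin q, ∀ p ∈ φ.source,
        L.anchor p (α (Fin.castLE hqr i) p) = coordVec φ (Fin.castLE hqm i) p) ∧
      (∀ s : Fin r, q ≤ (s : ℕ) → ∀ p ∈ φ.source,
        L.anchor p (α s p) = ∑ j ∈ {j : Fin m | q ≤ j.val}, b s j p • coordVec φ j p) ∧
      (∀ (s : Fin r) (j : Fin m), q ≤ (s : ℕ) → q ≤ (j : ℕ) →
        ContMDiffOn (𝓡 m) 𝓘(ℝ, ℝ) ∞ (b s j) φ.source ∧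
        (∀ p ∈ φ.source, ∀ p' ∈ φ.source,
          (∀ k : Fin m, q ≤ (k : ℕ) → φ p k = φ p' k) → b s j p = b s j p') ∧
        b s j x₀ = 0) := by
  obtain ⟨hqm, hqr, χ, G, b, hχ, hx₀, hχ0, hbase, hG, hb, hb0, hanchor⟩ :=
    L.exists_chart_normal_form hr x₀ hq
  set e := trivializationAt F A x₀
  let κ := splitEquiv hqm
  let v : Fin r → (Fin q → ℝ) × ({s : Fin r // q ≤ (s : ℕ)} → ℝ) := fun s =>
    splitEquiv hqr (EuclideanSpace.single s (1 : ℝ))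
  have hloc : ∀ s, ∃ σ : Cₛ^∞⟮𝓡 m; F, A⟯, ∀ᶠ x in 𝓝 x₀, σ x = e.symm x (G x (v s)) := by
    intro s
    refine exists_contMDiffSection_eventuallyEq χ.open_source hx₀ ?_
    rw [e.contMDiffOn_section_iff χ.open_source hbase]
    refine (hG.clm_apply (contMDiffOn_const (c := v s))).congr fun y hy => ?_
    rw [e.apply_mk_symm (hbase hy)]
  choose α hα using hloc
  obtain ⟨O, hOsub, hO, hx₀O⟩ := eventually_nhds_iff.1 (eventually_all.2 hα)
  have hκ : IsSmoothChart (m := m) (χ.trans κ.symm.toHomeomorph.toOpenPartialHomeomorph) :=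
    hχ.trans κ.symm.contDiff.contDiffOn κ.contDiff.contDiffOn
  set φ := (χ.trans κ.symm.toHomeomorph.toOpenPartialHomeomorph).restrOpen O hO with hφdef
  have hφ : IsSmoothChart (m := m) φ := hκ.restrOpen hO
  have hφsrc : ∀ p, p ∈ φ.source ↔ p ∈ χ.source ∧ p ∈ O := by
    intro p
    rw [hφdef, OpenPartialHomeomorph.restrOpen_source]
    simp
  have hφapp : ∀ p, φ p = κ.symm (χ p) := fun p => rfl
  have hφχ : ∀ p, χ p = κ (φ p) := fun p => (κ.apply_symm_apply _).symm
  have hdφ : ∀ p ∈ φ.source, ∀ Y : TangentSpace (𝓡 m) p,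
      mfderiv (𝓡 m) 𝓘(ℝ, (Fin q → ℝ) × ({j : Fin m // q ≤ (j : ℕ)} → ℝ)) χ p Y =
        κ (mfderiv (𝓡 m) (𝓡 m) φ p Y) := by
    intro p hp Y
    have h1 := hφ.mfderiv_comp_apply hp (κ.hasFDerivAt (x := φ p)) Y
    have h2 : (fun x => κ (φ x)) = χ := funext fun x => (hφχ x).symm
    rw [h2] at h1
    exact h1
  have hα' : ∀ s, ∀ p ∈ φ.source, α s p = e.symm p (G p (v s)) := fun s p hp =>
    hOsub p ((hφsrc p).1 hp).2 s
  have hanch : ∀ s, ∀ p ∈ φ.source, κ (mfderiv (𝓡 m) (𝓡 m) φ p (L.anchor p (α s p))) =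
      ((v s).1, b (κ (φ p)).2 (v s).2) := by
    intro s p hp
    have h1 := (hanchor p ((hφsrc p).1 hp).1).2 (v s)
    rw [← hα' s p hp, hφχ p] at h1
    exact (hdφ p hp _).symm.trans h1
  -- The value 0 is only a filler for indices below q.
  let B : Fin r → Fin m → M → ℝ := fun s j p =>
    if h : q ≤ (s : ℕ) ∧ q ≤ (j : ℕ) then b (κ (φ p)).2 (Pi.single ⟨s, h.1⟩ 1) ⟨j, h.2⟩ else 0
  have hB : ∀ (s : Fin r) (j : Fin m) (hs : q ≤ (s : ℕ)) (hj : q ≤ (j : ℕ)) p,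
      B s j p = b (κ (φ p)).2 (Pi.single ⟨s, hs⟩ 1) ⟨j, hj⟩ := fun s j hs hj p =>
    dif_pos ⟨hs, hj⟩
  have hφ0 : φ x₀ = 0 := by rw [hφapp, hχ0, map_zero]
  refine ⟨hqm, hqr, φ, α, B, hφ, (hφsrc x₀).2 ⟨hx₀, hx₀O⟩, hφ0, ?_, ?_, ?_, ?_⟩
  · have hframe : ∀ p (hp : p ∈ φ.source),
        ∃ ε : EuclideanSpace ℝ (Fin r) ≃ₗ[ℝ] A p,
          ∀ s, ε (EuclideanSpace.single s (1 : ℝ)) = α s p := by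
      intro p hp
      have hpχ := ((hφsrc p).1 hp).1
      refine ⟨((splitEquiv hqr).toLinearEquiv.trans (LinearEquiv.ofBijective
        (G p : _ →ₗ[ℝ] F) (hanchor p hpχ).1)).trans (e.linearEquivAt ℝ p (hbase hpχ)).symm,
        fun s => ?_⟩
      rw [hα' s p hp]
      rfl
    refine ⟨fun {p} hp => ?_, fun {p} hp => ?_, fun s => (α s).contMDiff.contMDiffOn⟩
    · obtain ⟨ε, hε⟩ := hframe p hp
      have h1 := ((EuclideanSpace.basisFun (Fin r) ℝ).toBasis.map ε).linearIndependent
      have h2 : (fun s => α s p) = (EuclideanSpace.basisFun (Fin r) ℝ).toBasis.map ε :=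
        funext fun s => by simp [hε]
      rw [h2]
      exact h1
    · obtain ⟨ε, hε⟩ := hframe p hp
      have h1 := ((EuclideanSpace.basisFun (Fin r) ℝ).toBasis.map ε).span_eq
      rw [← h1]
      refine le_of_eq (congrArg (fun f => Submodule.span ℝ (range f)) (funext fun s => ?_))
      simp [hε]
  · intro i p hp
    apply hφ.mfderiv_injective hp
    refine Eq.trans ?_ (mfderiv_coordVec hφ hp _).symm
    apply κ.injective
    refine (hanch _ p hp).trans ?_
    simp only [v, κ, splitEquiv_single_castLE, map_zero]
  · intro s hs p hp
    apply hφ.mfderiv_injective hp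
    have h1 : mfderiv (𝓡 m) (𝓡 m) φ p
        (∑ j ∈ {j : Fin m | q ≤ j.val}, B s j p • coordVec φ j p) =
        ∑ j ∈ {j : Fin m | q ≤ j.val}, B s j p • EuclideanSpace.single j (1 : ℝ) := by
      refine (map_sum _ _ _).trans (Finset.sum_congr rfl fun j _ => ?_)
      exact (map_smul _ _ _).trans (congrArg _ (mfderiv_coordVec hφ hp j))
    refine Eq.trans ?_ h1.symm
    apply κ.injective
    refine (hanch _ p hp).trans ?_
    simp only [v, splitEquiv_single_of_le hqr hs]
    refine Prod.ext (funext fun k => ?_) (funext fun j => ?_)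
    · simp only [κ, splitEquiv_apply_fst]
      simp [Pi.single_apply]
    · simp only [κ, splitEquiv_apply_snd]
      simp [Pi.single_apply, j.2, hB s j hs j.2]
      rfl
  · intro s j hs hj
    refine ⟨?_, fun p hp p' hp' h => ?_, ?_⟩
    · have h1 : ContDiff ℝ ∞ fun z => b (κ z).2 (Pi.single ⟨s, hs⟩ 1) ⟨j, hj⟩ :=
        (contDiff_apply ℝ ℝ _).comp
          ((hb.comp (contDiff_snd.comp κ.contDiff)).clm_apply contDiff_const)
      exact (h1.contMDiff.comp_contMDiffOn hφ.contMDiffOn).congr fun p _ => hB s j hs hj p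
    · have h1 : (κ (φ p)).2 = (κ (φ p')).2 := funext fun k => h k k.2
      rw [hB s j hs hj, hB s j hs hj, h1]
    · rw [hB s j hs hj, hφ0, map_zero]
      simp [hb0]

end Splitting
/-- Local splitting of a Lie algebroid of rank `r` over an `m`-manifold near a point `x₀` where the
anchor has rank `q`. All indices start at `0`: the coordinates of `φ` with index `< q` are the
`x`'s, those with index `≥ q` are the `y`'s, and `U = φ.source`. -/
theorem mainTheorem2 {m : ℕ} {M : Type*} [TopologicalSpace M] [T2Space M]
    [ChartedSpace (EuclideanSpace ℝ (Fin m)) M] [IsManifold (𝓡 m) ∞ M]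
    {F : Type*} [NormedAddCommGroup F] [NormedSpace ℝ F] [FiniteDimensional ℝ F]
    {A : M → Type*} [TopologicalSpace (TotalSpace F A)] [∀ x, TopologicalSpace (A x)]
    [FiberBundle F A] [∀ x, AddCommGroup (A x)] [∀ x, Module ℝ (A x)] [VectorBundle ℝ F A]
    [ContMDiffVectorBundle ∞ F A (𝓡 m)]
    (L : LieAlgebroid m M F A) (r q : ℕ) (hr : Module.finrank ℝ F = r)
    (x₀ : M) (hq : Module.finrank ℝ (LinearMap.range (L.anchor x₀)) = q) :
    ∃ (hqm : q ≤ m) (hqr : q ≤ r)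
      (φ : OpenPartialHomeomorph M (EuclideanSpace ℝ (Fin m)))
      (α : Fin r → Cₛ^∞⟮𝓡 m; F, A⟯)
      (b : Fin r → Fin m → M → ℝ) (c : Fin r → Fin r → Fin r → M → ℝ),
      -- `φ` is a smooth chart centred at `x₀`, and `α` is a basis of sections over its domain
      φ ∈ IsManifold.maximalAtlas (𝓡 m) ∞ M ∧ x₀ ∈ φ.source ∧ φ x₀ = 0 ∧
      IsLocalFrameOn (𝓡 m) F ∞ (fun s x => α s x) φ.source ∧
      -- the anchor on the first `q` sections
      (∀ i : Fin q, ∀ p ∈ φ.source,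
        L.anchor p (α (Fin.castLE hqr i) p) = coordVec φ (Fin.castLE hqm i) p) ∧
      -- the anchor on the other sections
      (∀ s : Fin r, q ≤ (s : ℕ) → ∀ p ∈ φ.source,
        L.anchor p (α s p) = ∑ j ∈ {j : Fin m | q ≤ j.val}, b s j p • coordVec φ j p) ∧
      -- the coefficients are smooth, depend on the `y`'s only, and vanish at `x₀`
      (∀ (s : Fin r) (j : Fin m), q ≤ (s : ℕ) → q ≤ (j : ℕ) →
        ContMDiffOn (𝓡 m) 𝓘(ℝ, ℝ) ∞ (b s j) φ.source ∧
        (∀ p ∈ φ.source, ∀ p' ∈ φ.source,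
          (∀ k : Fin m, q ≤ (k : ℕ) → φ p k = φ p' k) → b s j p = b s j p') ∧
        b s j x₀ = 0) ∧
      -- the structure functions of the bracket
      (∀ s t u : Fin r, ContMDiffOn (𝓡 m) 𝓘(ℝ, ℝ) ∞ (c s t u) φ.source) ∧
      (∀ s t : Fin r, ∀ p ∈ φ.source,
        L.bracket (α s) (α t) p = ∑ u : Fin r, c s t u p • α u p) ∧
      (∀ s t u : Fin r, (u : ℕ) < q → ∀ p ∈ φ.source, c s t u p = 0) ∧
      (∀ s t : Fin r, ∀ i : Fin q, ∀ j : Fin m, q ≤ (j : ℕ) → ∀ p ∈ φ.source,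
        ∑ u ∈ {u : Fin r | q ≤ u.val},
          coordDeriv φ (Fin.castLE hqm i) (c s t u) p * b u j p = 0) := by

  obtain ⟨hqm, hqr, φ, α, b, hφ, hx₀, hφ0, hα, h1, h2, hb⟩ := L.exists_anchor_splitting hr x₀ hq
  obtain ⟨c, hc⟩ := L.exists_structure_functions hqm hqr hφ hα h1 h2
    fun s j hs hj => (hb s j hs hj).2.1
  exact ⟨hqm, hqr, φ, α, b, c, hφ.mem_maximalAtlas, hx₀, hφ0, hα, h1, h2, hb, hc⟩
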